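/- **Conventions.** A *hyperring* is a set with a commutative multiplicative monoid structure with unit $1$ and absorbing element $0\neq 1$, and a commutative, associative multivalued addition with non-empty values, neutral element $0$, unique opposites and reversibility, such that $r(x+y)=rx+ry$ as sets. A *sheaf of hyperrings* on a space is a sheaf of sets with sections $0,1$ and with a multiplication and a multivalued addition whose graphs are subsheaves, such that all stalks are hyperrings. An isomorphism of sheaves of hyperrings is an isomorphism of sheaves of sets that identifies these sections and graphs. Let $\mathbb Q^{\rm cyc}$ be the field generated over $\mathbb Q$ by all roots of unity, $\mathcal O^{\rm cyc}$ its ring of integers, and $\pi:{\rm Spec}\,\mathcal O^{\rm cyc}\to{\rm Spec}\,\mathbb Z$ the canonical map. For a prime $p$ let $H(p)\subset\mathbb Q$ be the group of fractions whose denominator is a power of $p$. *Cartier side.* Let $\mathcal{C}a\mathcal{C}\ell({\rm Spec}\,\mathcal O^{\rm cyc})=\mathcal K/\mathcal O^\times$, where $\mathcal K$ is the constant sheaf $\mathbb Q^{\rm cyc}$: its stalk at $\wp$ is the quotient $\mathbb Q^{\rm cyc}/(\mathcal O^{\rm cyc}_\wp)^\times$, in which the sum of two classes is the set of classes of all sums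 of representatives, and its sections are the families of elements of the stalks that are locally the class of one element of $\mathbb Q^{\rm cyc}$. *Arithmetic site side.* Let $\mathbb N_0^\times$ be the multiplicative monoid of non-negative integers. Let $\mathcal S$ be the sheaf on ${\rm Spec}\,\mathbb Z$ whose sections over $U$ are the families $\xi_p\in H(p)^+=\{h\in H(p): h\ge 0\}$, for the primes $p\in U$, with only finitely many non-zero terms; its stalk is $H(p)^+$ at $p$ and $\{0\}$ at the generic point, and $\mathbb N_0^\times$ acts by multiplication. Let $\Theta:{\rm Spec}\,\mathbb Z\to\widehat{\mathbb N_0^\times}$ be the geometric morphism, to the topos of sets with an action of $\mathbb N_0^\times$, that $\mathcal S$ defines: $\Theta^*A$ is the sheaf associated with $U\mapsto A\otimes_{\mathbb N_0^\times}\Gamma(U,\mathcal S)$. Let $\mathcal O_h$ be the set $\mathbb Z\cup\{-\infty\}$, where $k\in\mathbb N_0^\times$ acts by $m\mapsto km$ and fixes $-\infty$, with product the addition of $\mathbb Z$ (absorbing element $-\infty$) and multivalued sum $x\vee y=\max(x,y)$ for $x\ne y$, $x\vee x=[-\infty,x]$. The sheaf $(\Theta\circ\pi)^*(\mathcal O_h)=\pi^*\Theta^*(\mathcal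 O_h)$ carries the inverse images of these operations. For $\pi(\wp)=p$, its stalk at $\wp$ is mapped to $H(p)\cup\{-\infty\}$ by $x\otimes h\mapsto xh$. **Proposition.** 1. For every prime $p$ and every prime ideal $\wp$ of $\mathcal O^{\rm cyc}$ above $p$ there is exactly one valuation $v_\wp:\mathbb Q^{\rm cyc}\to\mathbb Q\cup\{\infty\}$ with valuation ring $\mathcal O^{\rm cyc}_\wp$ and $v_\wp(p)=p-1$, and $v_\wp\big((\mathbb Q^{\rm cyc})^\times\big)=H(p)$. 2. $\mathcal{C}a\mathcal{C}\ell({\rm Spec}\,\mathcal O^{\rm cyc})$ and $(\Theta\circ\pi)^*(\mathcal O_h)$ are sheaves of hyperrings on ${\rm Spec}\,\mathcal O^{\rm cyc}$, and there is exactly one isomorphism of sheaves of hyperrings $$\Phi:\ \mathcal{C}a\mathcal{C}\ell({\rm Spec}\,\mathcal O^{\rm cyc})\ \stackrel{\sim}{\longrightarrow}\ (\Theta\circ\pi)^*(\mathcal O_h)$$ such that, whenever a section $s$ has at a closed point $\wp$ the class of $f\in\mathbb Q^{\rm cyc}$ as its germ, the germ of $\Phi(s)$ at $\wp$ has the value $-v_\wp(f)\in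 H(p)\cup\{-\infty\}$. -/

import Mathlib

open CategoryTheory TopologicalSpace Opposite

/-! ### Hyperrings and sheaves of hyperrings -/

/-- Two constants, a multiplication and a multivalued addition on `A`, given by their graphs:
`mul x y z` reads "`z` is the product of `x` and `y`" and `add x y z` reads "`z ∈ x + y`".
Graphs are used because an inverse image functor of topoi transports subobjects. -/
structure HyperStr (A : Type) where
  zero : A
  one : A
  mul : A → A → A → Prop
  add : A → A → A → Prop

/-- The axioms of a commutative (Krasner) hyperring: `(A, +, 0)` is a canonical hypergroup,
`(A, ·, 1)` is a commutative monoid with absorbing element `0 ≠ 1`,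
and `r (x + y) = r x + r y` as sets. -/
structure HyperStr.IsHyperring {A : Type} (h : HyperStr A) : Prop where
  add_nonempty : ∀ x y, ∃ z, h.add x y z
  add_comm : ∀ x y z, h.add x y z → h.add y x z
  add_zero : ∀ x z, h.add x h.zero z ↔ z = x
  add_assoc : ∀ x y z w,
    (∃ t, h.add x y t ∧ h.add t z w) ↔ (∃ t, h.add y z t ∧ h.add x t w)
  exists_unique_neg : ∀ x, ∃! y, h.add x y h.zero
  reversible : ∀ x x' y z, h.add x x' h.zero → h.add x y z → h.add z x' y
  mul_existsUnique : ∀ x y, ∃! z, h.mul x y z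
  mul_comm : ∀ x y z, h.mul x y z → h.mul y x z
  mul_assoc : ∀ x y z a b w, h.mul x y a → h.mul y z b → (h.mul a z w ↔ h.mul x b w)
  mul_one : ∀ x, h.mul x h.one x
  mul_zero : ∀ x, h.mul x h.zero h.zero
  distrib : ∀ r x y a b w, h.mul r x a → h.mul r y b →
    (h.add a b w ↔ ∃ z, h.add x y z ∧ h.mul r z w)
  zero_ne_one : h.zero ≠ h.one

/-- A sheaf of sets on `X`, presented by its stalks and by those families of germs which are
sections, together with constants, a multiplication and a multivalued addition on the stalks. -/
structure HyperSheaf (X : TopCat.{0}) where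
  stalk : X → Type
  sec : TopCat.LocalPredicate stalk
  str : ∀ x, HyperStr (stalk x)

namespace HyperSheaf

variable {X : TopCat.{0}}

/-- The underlying sheaf of sets. -/
def toSheaf (F : HyperSheaf X) : TopCat.Sheaf Type X := TopCat.subsheafToTypes F.sec

/-- The set of sections over `U`. -/
abbrev Sections (F : HyperSheaf X) (U : Opens X) : Type := F.toSheaf.presheaf.obj (op U)

/-- The germ at `x` of a section. -/
def germ (F : HyperSheaf X) {U : Opens X} (s : F.Sections U) (x : U) : F.stalk x.1 :=
  (show {f : ∀ x : U, F.stalk x.1 // F.sec.pred f} from s).1 x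

/-- `F` is a sheaf of hyperrings: `F.stalk x` is really the stalk at `x` of the sheaf of sections
(every element is the germ of a local section, and two sections with the same germ at `x` agree
near `x`), the constants are sections, the graphs of the operations are subsheaves, and all stalks
are hyperrings. -/
structure IsSheafOfHyperrings (F : HyperSheaf X) : Prop where
  exists_germ : ∀ (x : X) (t : F.stalk x), ∃ (U : Opens X) (hx : x ∈ U) (s : F.Sections U),
    F.germ s ⟨x, hx⟩ = t
  germ_ext : ∀ (U : Opens X) (s t : F.Sections U) (x : U), F.germ s x = F.germ t x →
    ∃ V : Opens X, x.1 ∈ V ∧ ∀ (y : U), y.1 ∈ V → F.germ s y = F.germ t y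
  zero_sec : ∀ U : Opens X, F.sec.pred fun x : U => (F.str x.1).zero
  one_sec : ∀ U : Opens X, F.sec.pred fun x : U => (F.str x.1).one
  mul_open : ∀ (U : Opens X) (r s t : F.Sections U) (x : U),
    (F.str x.1).mul (F.germ r x) (F.germ s x) (F.germ t x) →
    ∃ V : Opens X, x.1 ∈ V ∧ ∀ (y : U), y.1 ∈ V →
      (F.str y.1).mul (F.germ r y) (F.germ s y) (F.germ t y)
  add_open : ∀ (U : Opens X) (r s t : F.Sections U) (x : U),
    (F.str x.1).add (F.germ r x) (F.germ s x) (F.germ t x) →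
    ∃ V : Opens X, x.1 ∈ V ∧ ∀ (y : U), y.1 ∈ V →
      (F.str y.1).add (F.germ r y) (F.germ s y) (F.germ t y)
  hyperring : ∀ x, (F.str x).IsHyperring

/-- `t` is the product of the sections `r` and `s`. -/
def MulSec (F : HyperSheaf X) {U : Opens X} (r s t : F.Sections U) : Prop :=
  ∀ x : U, (F.str x.1).mul (F.germ r x) (F.germ s x) (F.germ t x)

/-- `t` belongs to the hypersum of the sections `r` and `s`. -/
def AddSec (F : HyperSheaf X) {U : Opens X} (r s t : F.Sections U) : Prop :=
  ∀ x : U, (F.str x.1).add (F.germ r x) (F.germ s x) (F.germ t x)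

/-- `s` is the zero section. -/
def IsZeroSec (F : HyperSheaf X) {U : Opens X} (s : F.Sections U) : Prop :=
  ∀ x : U, F.germ s x = (F.str x.1).zero

/-- `s` is the unit section. -/
def IsOneSec (F : HyperSheaf X) {U : Opens X} (s : F.Sections U) : Prop :=
  ∀ x : U, F.germ s x = (F.str x.1).one

/-- The image of a section under an isomorphism of sheaves of sets. -/
def mapSec {F G : HyperSheaf X} (Φ : F.toSheaf ≅ G.toSheaf) {U : Opens X} (s : F.Sections U) :
    G.Sections U :=
  Φ.hom.hom.app (op U) s

/-- An isomorphism of sheaves of sets is an isomorphism of sheaves of hyperrings when it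
identifies the constants and the graphs of the two operations. -/
structure IsHyperringIso {F G : HyperSheaf X} (Φ : F.toSheaf ≅ G.toSheaf) : Prop where
  zero_iff : ∀ {U : Opens X} (s : F.Sections U), F.IsZeroSec s ↔ G.IsZeroSec (mapSec Φ s)
  one_iff : ∀ {U : Opens X} (s : F.Sections U), F.IsOneSec s ↔ G.IsOneSec (mapSec Φ s)
  mul_iff : ∀ {U : Opens X} (r s t : F.Sections U),
    F.MulSec r s t ↔ G.MulSec (mapSec Φ r) (mapSec Φ s) (mapSec Φ t)
  add_iff : ∀ {U : Opens X} (r s t : F.Sections U),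
    F.AddSec r s t ↔ G.AddSec (mapSec Φ r) (mapSec Φ s) (mapSec Φ t)

/-- The inverse image of `F` under a continuous map `f : Y ⟶ X`: the stalk at `y` is the stalk
of `F` at `f y`, and the sections are locally of the form `s ∘ f` with `s` a section of `F`. -/
def inverseImage {Y : TopCat.{0}} (f : Y ⟶ X) (F : HyperSheaf X) : HyperSheaf Y where
  stalk y := F.stalk (f y)
  sec := TopCat.PrelocalPredicate.sheafify
    { pred := fun {U} t => ∃ (V : Opens X) (h : ∀ y : U, f y.1 ∈ V) (s : F.Sections V),
        ∀ y : U, t y = F.germ s ⟨f y.1, h y⟩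
      res := fun i _ ⟨V, h, s, hs⟩ =>
        ⟨V, fun y => h ⟨y.1, i.le y.2⟩, s, fun y => hs ⟨y.1, i.le y.2⟩⟩ }
  str y := F.str (f y)

end HyperSheaf

/-! ### The sheaf of hyperrings `𝒦 / 𝒪ˣ` of Cartier divisor classes -/

/-- The quotient `A / G` of a commutative ring by a subgroup of its group of units. -/
abbrev UnitQuotient (A : Type) [CommRing A] (G : Subgroup Aˣ) : Type :=
  MulAction.orbitRel.Quotient G A

/-- The class of `a` in `A / G`. -/
def UnitQuotient.mk {A : Type} [CommRing A] (G : Subgroup Aˣ) (a : A) : UnitQuotient A G :=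
  Quotient.mk (MulAction.orbitRel G A) a

/-- The hyperring structure of `A / G`: products of classes are classes of products, and the
hypersum of two classes consists of the classes of all sums of representatives. -/
def UnitQuotient.str (A : Type) [CommRing A] (G : Subgroup Aˣ) : HyperStr (UnitQuotient A G) where
  zero := mk G 0
  one := mk G 1
  mul x y z := ∃ a b : A, mk G a = x ∧ mk G b = y ∧ mk G (a * b) = z
  add x y z := ∃ a b : A, mk G a = x ∧ mk G b = y ∧ mk G (a + b) = z

section CartierDivisors

variable (R K : Type) [CommRing R] [IsDomain R] [Field K] [Algebra R K] [IsFractionRing R K]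

/-- The local ring of `Spec R` at `x`, inside the fraction field `K` of `R`. -/
def localRing (x : PrimeSpectrum R) : Set K :=
  {f | ∃ a b : R, b ∉ x.asIdeal ∧ f * algebraMap R K b = algebraMap R K a}

/-- The units of the local ring of `Spec R` at `x`, as a subgroup of `Kˣ`. -/
def localUnits (x : PrimeSpectrum R) : Subgroup Kˣ where
  carrier := {u | (u : K) ∈ localRing R K x ∧ ((u⁻¹ : Kˣ) : K) ∈ localRing R K x}
  one_mem' := by
    have h : (1 : R) ∉ x.asIdeal := (Ideal.ne_top_iff_one _).mp x.isPrime.ne_top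
    exact ⟨⟨1, 1, h, by simp⟩, ⟨1, 1, h, by simp⟩⟩
  mul_mem' := by
    have key : ∀ f g : K, f ∈ localRing R K x → g ∈ localRing R K x →
        f * g ∈ localRing R K x := by
      rintro f g ⟨a, b, hb, h⟩ ⟨a', b', hb', h'⟩
      refine ⟨a * a', b * b', fun hm => ?_, ?_⟩
      · rcases x.isPrime.mem_or_mem hm with h1 | h1
        · exact hb h1
        · exact hb' h1
      · rw [map_mul, map_mul, ← h, ← h']; ring
    rintro u v ⟨hu, hu'⟩ ⟨hv, hv'⟩
    refine ⟨?_, ?_⟩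
    · rw [Units.val_mul]; exact key _ _ hu hv
    · rw [mul_inv, Units.val_mul]; exact key _ _ hu' hv'
  inv_mem' := by
    rintro u ⟨hu, hu'⟩
    exact ⟨hu', by rwa [inv_inv]⟩

/-- The sheaf of hyperrings `𝒦 / 𝒪ˣ` on the integral scheme `Spec R`. Here `𝒦` is the constant
sheaf `K`, the stalk at `x` is `K / 𝒪ₓˣ`, and a section of the quotient sheaf is a family of
elements of these stalks which is locally the class of one element of `K`. -/
def cartierSheaf : HyperSheaf (TopCat.of (PrimeSpectrum R)) where
  stalk x := UnitQuotient K (localUnits R K x)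
  sec := TopCat.PrelocalPredicate.sheafify
    { pred := fun {U} s => ∃ f : K, ∀ x : U, s x = UnitQuotient.mk (localUnits R K x.1) f
      res := fun i _ ⟨f, hf⟩ => ⟨f, fun x => hf ⟨x.1, i.le x.2⟩⟩ }
  str x := UnitQuotient.str K (localUnits R K x)

end CartierDivisors

/-! ### The morphism `Θ` from `Spec ℤ` to the topos of sets with an action of the
multiplicative monoid `ℕ` (zero included), and the structure sheaf -/

/-- The group `H(p)` of fractions whose denominator is a power of `p`. -/
def fractionGroup (p : ℕ) : AddSubgroup ℚ where
  carrier := {x | ∃ (k : ℕ) (m : ℤ), x * (p : ℚ) ^ k = m}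
  zero_mem' := ⟨0, 0, by simp⟩
  add_mem' := by
    rintro x y ⟨k, m, h⟩ ⟨l, n, h'⟩
    refine ⟨k + l, m * (p : ℤ) ^ l + n * (p : ℤ) ^ k, ?_⟩
    push_cast
    rw [← h, ← h', pow_add]; ring
  neg_mem' := by
    rintro x ⟨k, m, h⟩
    exact ⟨k, -m, by push_cast; rw [← h]; ring⟩

/-- The stalks of the sheaf `𝒮` on `Spec ℤ` which defines `Θ`: the set `H(p)⁺` of non-negative
elements of `H(p)` at the prime `p`, and `{0}` at the generic point. -/
def thetaStalk (q : PrimeSpectrum ℤ) : Set ℚ :=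
  {x | 0 ≤ x ∧ (x = 0 ∨ ∃ p : ℕ, p.Prime ∧ (p : ℤ) ∈ q.asIdeal ∧ x ∈ fractionGroup p)}

/-- The zero element of a stalk of `𝒮`. -/
def thetaZero (q : PrimeSpectrum ℤ) : thetaStalk q := ⟨0, le_refl 0, Or.inl rfl⟩

/-- The multiplicative monoid `ℕ` acts on the stalks of `𝒮` by multiplication. -/
instance thetaAction (q : PrimeSpectrum ℤ) : MulAction ℕ (thetaStalk q) where
  smul n x := ⟨n * (x : ℚ), mul_nonneg n.cast_nonneg x.2.1, by
    rcases x.2.2 with h | ⟨p, hp, hq, h⟩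
    · left; rw [h, mul_zero]
    · right
      refine ⟨p, hp, hq, ?_⟩
      rw [← nsmul_eq_mul]
      exact (fractionGroup p).nsmul_mem h n⟩
  one_smul x := Subtype.ext (show ((1 : ℕ) : ℚ) * (x : ℚ) = x by simp)
  mul_smul m n x := Subtype.ext
    (show ((m * n : ℕ) : ℚ) * (x : ℚ) = m * (n * (x : ℚ)) by push_cast; ring)

/-- A section of `𝒮` over `U` is a family of elements of the stalks, only finitely many of
which are non-zero. -/
def IsThetaSection {U : Opens (TopCat.of (PrimeSpectrum ℤ))} (c : ∀ q : U, thetaStalk q.1) :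
    Prop :=
  {q : U | (c q : ℚ) ≠ 0}.Finite

/-- The relations `n • x ⊗ y = x ⊗ n • y` of a tensor product over the multiplicative
monoid `ℕ`. -/
inductive MonoidTensor.Rel (A B : Type) [MulAction ℕ A] [MulAction ℕ B] : A × B → A × B → Prop
  | smul (n : ℕ) (x : A) (y : B) : Rel A B (n • x, y) (x, n • y)

/-- The tensor product of two sets with an action of the multiplicative monoid `ℕ`. -/
def MonoidTensor (A B : Type) [MulAction ℕ A] [MulAction ℕ B] : Type :=
  Quot (MonoidTensor.Rel A B)

/-- The pure tensor `x ⊗ y`. -/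
def MonoidTensor.tmul {A B : Type} [MulAction ℕ A] [MulAction ℕ B] (x : A) (y : B) :
    MonoidTensor A B :=
  Quot.mk _ (x, y)

/-- The inverse image functor `Θ^*`, applied to an object `A` of the presheaf topos of the
multiplicative monoid `ℕ` (a set with an action of `ℕ`) that carries equivariant constants and
operations. As `Θ` is given by the flat functor `𝒮`, the sheaf `Θ^* A` is associated with the
presheaf `U ↦ A ⊗ Γ(U, 𝒮)`, its stalks are `A ⊗ 𝒮_q`, and the graph of an operation is the image
of the inverse image of the graph `Γ ⊆ A × A × A`, that is, of `Γ ⊗ 𝒮_q`. -/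
def thetaInverseImage (A : Type) [MulAction ℕ A] (h : HyperStr A) :
    HyperSheaf (TopCat.of (PrimeSpectrum ℤ)) where
  stalk q := MonoidTensor A (thetaStalk q)
  sec := TopCat.PrelocalPredicate.sheafify
    { pred := fun {U} s => ∃ (x : A) (c : ∀ q : U, thetaStalk q.1), IsThetaSection c ∧
        ∀ q : U, s q = MonoidTensor.tmul x (c q)
      res := fun i _ ⟨x, c, hc, h⟩ => ⟨x, fun q => c ⟨q.1, i.le q.2⟩,
        Set.Finite.of_injOn (f := fun q => ⟨q.1, i.le q.2⟩) (fun _ hq => hq)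
          (fun _ _ _ _ e => Subtype.ext (congrArg (fun z => z.1) e)) hc,
        fun q => h ⟨q.1, i.le q.2⟩⟩ }
  str q :=
    { zero := MonoidTensor.tmul h.zero (thetaZero q)
      one := MonoidTensor.tmul h.one (thetaZero q)
      mul := fun r s t => ∃ (x y z : A) (c : thetaStalk q), h.mul x y z ∧
        MonoidTensor.tmul x c = r ∧ MonoidTensor.tmul y c = s ∧ MonoidTensor.tmul z c = t
      add := fun r s t => ∃ (x y z : A) (c : thetaStalk q), h.add x y z ∧
        MonoidTensor.tmul x c = r ∧ MonoidTensor.tmul y c = s ∧ MonoidTensor.tmul z c = t }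

/-- The set `ℤ ∪ {-∞}` underlying `ℤ_max`. (A type of its own, because the action of `0` below
fixes `-∞`.) -/
def ZMax : Type := WithBot ℤ

/-- The action of the multiplicative monoid `ℕ` on `ℤ_max` by `k • m = k m`,
`k • (-∞) = -∞`; in particular `0 • (-∞) = -∞`. -/
instance : MulAction ℕ ZMax where
  smul k x := WithBot.map (fun m : ℤ => (k : ℤ) * m) (show WithBot ℤ from x)
  one_smul x := by
    cases x using WithBot.recBotCoe with
    | bot => rfl
    | coe m => exact congrArg (fun z : ℤ => (z : WithBot ℤ)) (by simp)
  mul_smul j k x := by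
    cases x using WithBot.recBotCoe with
    | bot => rfl
    | coe m => exact congrArg (fun z : ℤ => (z : WithBot ℤ)) (by push_cast; ring)

/-- `ℤ_hmax`: the product of `ℤ_max` is the addition of `ℤ`, its zero is `-∞` and its unit is `0`.
The sum of two distinct elements is their maximum, and `x + x` is the interval `[-∞, x]`. -/
def zHmax : HyperStr ZMax where
  zero := (⊥ : WithBot ℤ)
  one := (0 : WithBot ℤ)
  mul x y z := (show WithBot ℤ from z) = (show WithBot ℤ from x) + (show WithBot ℤ from y)
  add x y z :=
    ((show WithBot ℤ from x) ≠ (show WithBot ℤ from y) ∧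
      (show WithBot ℤ from z) = max (show WithBot ℤ from x) (show WithBot ℤ from y)) ∨
    ((show WithBot ℤ from x) = (show WithBot ℤ from y) ∧
      (show WithBot ℤ from z) ≤ (show WithBot ℤ from x))

/-- The canonical map `x ⊗ y ↦ x y` from a stalk of `Θ^* ℤ_max` to `ℚ ∪ {-∞}`
(with `(-∞) y = -∞` for all `y`, including `y = 0`). At the prime `p` it identifies the stalk
with `H(p)_max`. -/
def stalkValue (q : PrimeSpectrum ℤ) (t : MonoidTensor ZMax (thetaStalk q)) : WithBot ℚ :=
  Quot.lift
    (fun z : ZMax × thetaStalk q =>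
      WithBot.map (fun m : ℤ => (m : ℚ) * (z.2 : ℚ)) (show WithBot ℤ from z.1))
    (by
      rintro _ _ ⟨n, x, y⟩
      cases x using WithBot.recBotCoe with
      | bot => rfl
      | coe m =>
        refine congrArg (fun z : ℚ => (z : WithBot ℚ)) ?_
        change (((n : ℤ) * m : ℤ) : ℚ) * (y : ℚ) = (m : ℚ) * ((n : ℚ) * (y : ℚ))
        push_cast; ring)
    t

/-! ### Cyclotomic integers and normalized valuations -/

/-- The field `ℚ^cyc` generated by all roots of unity. -/
abbrev Qcyc : Type :=
  IntermediateField.adjoin ℚ {z : ℂ | ∃ n : ℕ, 0 < n ∧ z ^ n = 1}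

/-- The ring of cyclotomic integers, that is, the ring of integers of `ℚ^cyc`. -/
abbrev Ocyc : Type := NumberField.RingOfIntegers Qcyc

instance : Algebra.IsAlgebraic ℚ Qcyc :=
  IntermediateField.isAlgebraic_adjoin fun _ ⟨_, hn, hz⟩ =>
    IsIntegral.of_pow hn (hz ▸ isIntegral_one)

instance : IsFractionRing Ocyc Qcyc :=
  have : Algebra.IsAlgebraic ℤ Qcyc :=
    (IsFractionRing.comap_isAlgebraic_iff (A := ℤ) (K := ℚ) (C := Qcyc)).mpr inferInstance
  IsIntegralClosure.isFractionRing_of_algebraic ℤ Ocyc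
    fun _ hx => (FaithfulSMul.algebraMap_eq_zero_iff ℤ Qcyc).mp hx

/-- The morphism `π : Spec 𝒪^cyc ⟶ Spec ℤ`, on the underlying spaces. -/
noncomputable def specMap : TopCat.of (PrimeSpectrum Ocyc) ⟶ TopCat.of (PrimeSpectrum ℤ) :=
  TopCat.ofHom ⟨PrimeSpectrum.comap (algebraMap ℤ Ocyc), PrimeSpectrum.continuous_comap _⟩

/-- `v` is the valuation of `ℚ^cyc` whose valuation ring is the local ring at `℘`, normalized by
`v p = p - 1`, where `p` is the residue characteristic of `℘`. -/
structure IsNormalizedValuation (p : ℕ) (P : PrimeSpectrum Ocyc)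
    (v : AddValuation Qcyc (WithTop ℚ)) : Prop where
  nonneg_iff : ∀ f : Qcyc, 0 ≤ v f ↔ f ∈ localRing Ocyc Qcyc P
  map_prime : v (p : Qcyc) = (((p : ℚ) - 1 : ℚ) : WithTop ℚ)

/-- The map `r ↦ -r` from `ℚ ∪ {+∞}` to `ℚ ∪ {-∞}`. -/
def negValue (r : WithTop ℚ) : WithBot ℚ :=
  WithTop.recTopCoe (C := fun _ => WithBot ℚ) ⊥ (fun a : ℚ => ((-a : ℚ) : WithBot ℚ)) r

/-- The sheaf of hyperrings `(Θ ∘ π)^* 𝒪_h = π^* Θ^* 𝒪_h` on `Spec 𝒪^cyc`. -/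
noncomputable def pullbackStructureSheaf : HyperSheaf (TopCat.of (PrimeSpectrum Ocyc)) :=
  (thetaInverseImage ZMax zHmax).inverseImage specMap

/-!
Let `ζ` be a root of unity of order `p ^ (k + 1)` times a number prime to `p`. Then `p` has
ramification index `p ^ k * (p - 1)` in `ℚ(ζ)`, so normalizing the valuations above `p` by
`v p = p - 1` gives `ℚ(ζ)` the value group `p ^ (-k) ℤ`, and the union over all `ζ` is `H(p)`.
Powers of `1 - ζ`, with `ζ` of order `p ^ (k + 1)`, attain all these values, simultaneously at all
primes above `p`, and are units at all other primes.

The stalks of both sheaves over `p` are the tropical hyperring `H(p) ∪ {-∞}`, where `z ∈ x + y`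
means that the maximum of `x`, `y`, `z` is attained at least twice: on the Cartier side because `1`
is a sum of two units, and on the side of `Θ` because finitely many elements of `H(p)` are integral
multiples of one element. In both sheaves two sections which agree at a point agree near it, so the
isomorphisms of stalks glue as soon as every germ on one side extends to a section which
corresponds to a section on the other side: take the class of a power of `1 - ζ`, and the section
which is `x ⊗ c` over `p` and `x ⊗ 0` elsewhere.

The values determine the isomorphism at the closed points, and the stalks at the generic point
are `{0, 1}`.
-/

open HyperSheaf

/-! ### Local rings of an integral scheme -/

section LocalRing

variable {R K : Type} [CommRing R] [Field K] [Algebra R K] {x : PrimeSpectrum R}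

variable (R K x) [IsDomain R] [IsFractionRing R K] in
/-- The local ring of `Spec R` at `x` as a subring of the fraction field, the localization at the
complement of the prime ideal. -/
noncomputable def localSubring : Subring K :=
  (Localization.subalgebra.ofField K x.asIdeal.primeCompl
    x.asIdeal.primeCompl_le_nonZeroDivisors).toSubring.copy (localRing R K x) <| by
    ext f
    refine exists_congr fun a => exists_congr fun b => exists_prop.symm.trans <|
      exists_congr fun hb => (eq_mul_inv_iff_mul_eq₀ fun h => hb ?_).symm
    rw [(FaithfulSMul.algebraMap_eq_zero_iff R K).mp h]
    exact zero_mem _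

theorem algebraMap_mem_localRing (a : R) : algebraMap R K a ∈ localRing R K x :=
  ⟨a, 1, (Ideal.ne_top_iff_one _).mp x.isPrime.ne_top, by rw [map_one, mul_one]⟩

theorem mem_localUnits_of_notMem {u : Kˣ} {a : R} (ha : a ∉ x.asIdeal)
    (hu : (u : K) = algebraMap R K a) : u ∈ localUnits R K x :=
  ⟨hu ▸ algebraMap_mem_localRing a, 1, a, ha, by rw [← hu, map_one, Units.inv_mul]⟩

theorem map_algebraMap_mem_localUnits (u : Rˣ) :
    u.map (algebraMap R K : R →* K) ∈ localUnits R K x :=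
  mem_localUnits_of_notMem
    (fun h => x.isPrime.ne_top (Ideal.eq_top_of_isUnit_mem _ h u.isUnit)) rfl

theorem mem_localRing_of_asIdeal_eq_bot [IsDomain R] [IsFractionRing R K] (hx : x.asIdeal = ⊥)
    (f : K) : f ∈ localRing R K x := by
  obtain ⟨a, b, hb, rfl⟩ := IsFractionRing.div_surjective (A := R) f
  have hb0 : b ≠ 0 := nonZeroDivisors.ne_zero hb
  exact ⟨a, b, by rwa [hx], div_mul_cancel₀ _ ((map_ne_zero_iff _
    (FaithfulSMul.algebraMap_injective R K)).mpr hb0)⟩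

theorem UnitQuotient.mk_eq_mk_iff {A : Type} [CommRing A] {G : Subgroup Aˣ} {f g : A} :
    mk G f = mk G g ↔ ∃ u ∈ G, u * g = f := by
  rw [mk, mk, Quotient.eq, MulAction.orbitRel_apply, MulAction.mem_orbit_iff]
  exact ⟨fun ⟨⟨u, hu⟩, h⟩ => ⟨u, hu, h⟩, fun ⟨u, hu, h⟩ => ⟨⟨u, hu⟩, h⟩⟩

theorem exists_opens_forall_mem_localUnits {u : Kˣ} (hu : u ∈ localUnits R K x) :
    ∃ U : Opens (TopCat.of (PrimeSpectrum R)), x ∈ U ∧ ∀ y ∈ U, u ∈ localUnits R K y := by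
  obtain ⟨⟨a, b, hb, h⟩, ⟨a', b', hb', h'⟩⟩ := hu
  refine ⟨PrimeSpectrum.basicOpen b ⊓ PrimeSpectrum.basicOpen b', ⟨hb, hb'⟩, fun y hy => ?_⟩
  exact ⟨⟨a, b, hy.1, h⟩, ⟨a', b', hy.2, h'⟩⟩

variable {Γ : Type} [LinearOrderedAddCommGroupWithTop Γ] {w : AddValuation K Γ}

/-- The valuation ring of `w` is the local ring of `Spec R` at `x`. -/
def HasLocalRing (w : AddValuation K Γ) (x : PrimeSpectrum R) : Prop :=
  ∀ f, 0 ≤ w f ↔ f ∈ localRing R K x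

namespace HasLocalRing

theorem mem_localUnits_iff (hw : HasLocalRing w x) {u : Kˣ} : u ∈ localUnits R K x ↔ w u = 0 := by
  change (u : K) ∈ localRing R K x ∧ ((u⁻¹ : Kˣ) : K) ∈ localRing R K x ↔ _
  rw [← hw, ← hw]
  have hinv : w u + w (u⁻¹ : Kˣ) = 0 := by rw [← w.map_mul, u.mul_inv, w.map_one]
  refine ⟨fun ⟨h, h'⟩ => le_antisymm ?_ h, fun h => ⟨h.ge, ?_⟩⟩
  · exact hinv ▸ le_add_of_nonneg_right h'
  · rw [h, zero_add] at hinv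
    exact hinv.ge

theorem map_eq_of_associated (hw : HasLocalRing w x) {a b : R} (h : Associated a b) :
    w (algebraMap R K a) = w (algebraMap R K b) := by
  obtain ⟨u, rfl⟩ := h
  have hwu := hw.mem_localUnits_iff.mp (map_algebraMap_mem_localUnits u)
  rw [map_mul, w.map_mul]
  exact (add_zero _).symm.trans (congrArg _ hwu.symm)

theorem mk_eq_mk_iff (hw : HasLocalRing w x) {f g : K} :
    UnitQuotient.mk (localUnits R K x) f = UnitQuotient.mk (localUnits R K x) g ↔ w f = w g := by
  rw [UnitQuotient.mk_eq_mk_iff]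
  constructor
  · rintro ⟨u, hu, rfl⟩
    rw [w.map_mul, hw.mem_localUnits_iff.mp hu, zero_add]
  intro h
  by_cases hg : g = 0
  · rw [hg, w.map_zero, w.top_iff] at h
    exact ⟨1, one_mem _, by rw [h, hg, mul_zero]⟩
  have hf : f ≠ 0 := by
    rwa [← w.ne_top_iff, h, w.ne_top_iff]
  refine ⟨Units.mk0 (f / g) (div_ne_zero hf hg), hw.mem_localUnits_iff.mpr ?_,
    div_mul_cancel₀ f hg⟩
  rw [Units.val_mk0, w.map_div, h]
  exact LinearOrderedAddCommGroupWithTop.sub_self_eq_zero_of_ne_top (w.ne_top_iff.mpr hg)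

end HasLocalRing

end LocalRing

/-! ### Valuations with rational logarithms -/

section RatLog

variable {Γ₀ : Type} [LinearOrderedCommGroupWithZero Γ₀] {ϖ γ δ : Γ₀} {r s : ℚ}

/-- `r` is the logarithm of `γ` to the base `ϖ`, that is, `γ = ϖ ^ r`, written without roots. -/
def IsRatLog (ϖ γ : Γ₀) (r : ℚ) : Prop :=
  γ ^ r.den = ϖ ^ r.num

theorem isRatLog_iff_of_mul_eq {e : ℕ} {a : ℤ} (he : e ≠ 0) (h : r * e = a) :
    IsRatLog ϖ γ r ↔ γ ^ e = ϖ ^ a := by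
  have hnum : r.num * e = a * r.den := by
    have : (r.num : ℚ) * e = a * r.den := by rw [← h, mul_right_comm, Rat.mul_den_eq_num]
    exact_mod_cast this
  rw [IsRatLog, ← pow_left_inj₀ zero_le zero_le he, ← pow_mul, mul_comm r.den, pow_mul,
    ← zpow_natCast (ϖ ^ r.num), ← zpow_mul, hnum, zpow_mul, zpow_natCast,
    pow_left_inj₀ zero_le zero_le r.den_ne_zero]

theorem exists_common_denominator (r s : ℚ) :
    ∃ (e : ℕ) (a b : ℤ), e ≠ 0 ∧ r * e = a ∧ s * e = b := by
  refine ⟨r.den * s.den, r.num * s.den, s.num * r.den,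
    mul_ne_zero r.den_ne_zero s.den_ne_zero, ?_, ?_⟩
  · rw [Nat.cast_mul, ← mul_assoc, Rat.mul_den_eq_num, Int.cast_mul, Int.cast_natCast]
  · rw [Nat.cast_mul, mul_left_comm, Rat.mul_den_eq_num, Int.cast_mul, Int.cast_natCast, mul_comm]

namespace IsRatLog

theorem mul (hϖ : ϖ ≠ 0) (hγ : IsRatLog ϖ γ r) (hδ : IsRatLog ϖ δ s) :
    IsRatLog ϖ (γ * δ) (r + s) := by
  obtain ⟨e, a, b, he, hr, hs⟩ := exists_common_denominator r s
  have hrs : (r + s) * e = (a + b : ℤ) := by rw [add_mul, hr, hs, Int.cast_add]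
  rw [isRatLog_iff_of_mul_eq he hrs, mul_pow, zpow_add₀ hϖ, (isRatLog_iff_of_mul_eq he hr).mp hγ,
    (isRatLog_iff_of_mul_eq he hs).mp hδ]

theorem le_iff (h0 : ϖ ≠ 0) (h1 : ϖ < 1) (hγ : IsRatLog ϖ γ r) (hδ : IsRatLog ϖ δ s) :
    γ ≤ δ ↔ s ≤ r := by
  obtain ⟨e, a, b, he, hr, hs⟩ := exists_common_denominator r s
  have he' : (0 : ℚ) < e := Nat.cast_pos.mpr (Nat.pos_of_ne_zero he)
  rw [← pow_le_pow_iff_left₀ zero_le zero_le he, (isRatLog_iff_of_mul_eq he hr).mp hγ,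
    (isRatLog_iff_of_mul_eq he hs).mp hδ,
    zpow_le_zpow_iff_right_of_lt_one₀ (zero_lt_iff.mpr h0) h1, ← mul_le_mul_iff_left₀ he', hr, hs,
    Int.cast_le]

theorem unique (h0 : ϖ ≠ 0) (h1 : ϖ < 1) (hr : IsRatLog ϖ γ r) (hs : IsRatLog ϖ γ s) : r = s :=
  le_antisymm ((hs.le_iff h0 h1 hr).mp le_rfl) ((hr.le_iff h0 h1 hs).mp le_rfl)

theorem one : IsRatLog ϖ 1 0 := by
  rw [IsRatLog, one_pow, Rat.num_zero, zpow_zero]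

theorem self : IsRatLog ϖ ϖ 1 := by
  rw [IsRatLog, Rat.den_one, pow_one, Rat.num_one, zpow_one]

end IsRatLog

variable {K : Type} [Field K] {v : Valuation K Γ₀} {π : K} {c : ℚ}

theorem exists_addValuation_of_isRatLog (h0 : π ≠ 0) (h1 : v π < 1)
    (h : ∀ f ≠ 0, ∃ r, IsRatLog (v π) (v f) r) (hc : 0 < c) :
    ∃ w : AddValuation K (WithTop ℚ), (∀ f, 0 ≤ w f ↔ v f ≤ 1) ∧ w π = c := by
  classical
  have hπ : v π ≠ 0 := v.ne_zero_iff.mpr h0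
  choose! ρ hρ using h
  let w (f : K) : WithTop ℚ := if f = 0 then ⊤ else (ρ f * c : ℚ)
  have w_zero : w 0 = ⊤ := if_pos rfl
  have w_of_ne {f : K} (hf : f ≠ 0) : w f = (ρ f * c : ℚ) := if_neg hf
  have w_eq {f : K} {r : ℚ} (hf : f ≠ 0) (hr : IsRatLog (v π) (v f) r) : w f = (r * c : ℚ) := by
    rw [w_of_ne hf, (hρ f hf).unique hπ h1 hr]
  have w_le_iff (f g : K) : w g ≤ w f ↔ v f ≤ v g := by
    rcases eq_or_ne f 0 with rfl | hf
    · rw [w_zero, v.map_zero]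
      exact iff_of_true le_top zero_le
    rcases eq_or_ne g 0 with rfl | hg
    · rw [w_zero, v.map_zero, w_of_ne hf]
      exact iff_of_false (WithTop.coe_lt_top _).not_ge
        (zero_lt_iff.mpr (v.ne_zero_iff.mpr hf)).not_ge
    rw [w_of_ne hf, w_of_ne hg, WithTop.coe_le_coe, mul_le_mul_iff_left₀ hc,
      (hρ f hf).le_iff hπ h1 (hρ g hg)]
  have w_one : w 1 = 0 := by
    rw [w_eq one_ne_zero (v.map_one.symm ▸ IsRatLog.one), zero_mul, WithTop.coe_zero]
  have w_add (f g : K) : min (w f) (w g) ≤ w (f + g) := by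
    rw [min_le_iff, w_le_iff, w_le_iff]
    exact le_max_iff.mp (v.map_add f g)
  have w_mul (f g : K) : w (f * g) = w f + w g := by
    rcases eq_or_ne f 0 with rfl | hf
    · rw [zero_mul, w_zero, top_add]
    rcases eq_or_ne g 0 with rfl | hg
    · rw [mul_zero, w_zero, add_top]
    rw [w_eq (mul_ne_zero hf hg) (v.map_mul f g ▸ (hρ f hf).mul hπ (hρ g hg)), w_of_ne hf,
      w_of_ne hg, add_mul, WithTop.coe_add]
  refine ⟨.of w w_zero w_one w_add w_mul, fun f => ?_, ?_⟩
  · rw [AddValuation.of_apply, ← w_one, w_le_iff, v.map_one]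
  · rw [AddValuation.of_apply, w_eq h0 .self, one_mul]

theorem map_zpow_of_eq {w : AddValuation K (WithTop ℚ)} {f : K} (hf : w f = c) (n : ℤ) :
    w (f ^ n) = (n * c : ℚ) := by
  have hpow (m : ℕ) : w (f ^ m) = (m * c : ℚ) := by
    rw [w.map_pow, hf, ← nsmul_eq_mul, WithTop.coe_nsmul]
  cases n with
  | ofNat m => simpa using hpow m
  | negSucc m =>
    rw [zpow_negSucc, w.map_inv, hpow, ← WithTop.LinearOrderedAddCommGroup.coe_neg, ← neg_mul,
      Int.cast_negSucc]

theorem map_eq_of_isRatLog {w : AddValuation K (WithTop ℚ)} (hw : ∀ f, 0 ≤ w f ↔ v f ≤ 1)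
    (hπ : w π = c) {f : K} (hf : f ≠ 0) {r : ℚ} (hr : IsRatLog (v π) (v f) r) :
    w f = (r * c : ℚ) := by
  obtain ⟨q, hq⟩ := WithTop.ne_top_iff_exists.mp (w.ne_top_iff.mpr hf)
  have hequiv : v.IsEquiv (AddValuation.toValuation w) :=
    Valuation.isEquiv_of_val_le_one fun g => (hw g).symm
  have hvf : v (f ^ (r.den : ℤ)) = v (π ^ r.num) := by
    rw [map_zpow₀, map_zpow₀, zpow_natCast, hr]
  have hwf : w (f ^ (r.den : ℤ)) = w (π ^ r.num) := hequiv.eq_iff.mp hvf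
  rw [map_zpow_of_eq hq.symm, map_zpow_of_eq hπ, WithTop.coe_inj, Int.cast_natCast,
    ← Rat.mul_den_eq_num, mul_right_comm, mul_comm] at hwf
  rw [← hq, mul_right_cancel₀ (Nat.cast_ne_zero.mpr r.den_ne_zero) hwf]

end RatLog

/-! ### Primes of the integers of an algebraic extension of `ℚ` -/

section IntegralClosure

open NumberField IsDedekindDomain IntermediateField

section NumberField

variable {F : Type} [Field F] {w : HeightOneSpectrum (𝓞 F)} {p : ℕ}

theorem liesOver_span_of_mem (hp : p.Prime) (hw : (p : 𝓞 F) ∈ w.asIdeal) :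
    w.asIdeal.LiesOver (Ideal.span {(p : ℤ)}) := by
  have hmax : (Ideal.span {(p : ℤ)}).IsMaximal :=
    PrincipalIdealRing.isMaximal_of_irreducible (Nat.prime_iff_prime_int.mp hp).irreducible
  refine ⟨hmax.eq_of_le (Ideal.comap_isPrime _ _).ne_top ?_⟩
  rwa [Ideal.span_singleton_le_iff_mem, Ideal.mem_comap, map_natCast]

theorem valuation_natCast_prime [NumberField F] (hp : p.Prime) (hw : (p : 𝓞 F) ∈ w.asIdeal) :
    w.asIdeal.ramificationIdx ℤ ≠ 0 ∧
      w.valuation F p = WithZero.exp (-(w.asIdeal.ramificationIdx ℤ : ℤ)) := by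
  have hpZ : Prime (p : ℤ) := Nat.prime_iff_prime_int.mp hp
  let v : HeightOneSpectrum ℤ :=
    ⟨Ideal.span {(p : ℤ)}, (Ideal.span_singleton_prime hpZ.ne_zero).mpr hpZ,
      mt Ideal.span_singleton_eq_bot.mp hpZ.ne_zero⟩
  have : w.asIdeal.LiesOver v.asIdeal := liesOver_span_of_mem hp hw
  rw [← Ideal.ramificationIdx'_eq_ramificationIdx v.asIdeal _ v.ne_bot]
  refine ⟨Ideal.IsDedekindDomain.ramificationIdx'_ne_zero_of_liesOver _ v.ne_bot, ?_⟩
  have hv : v.valuation ℚ p = WithZero.exp (-1) := by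
    rw [← map_natCast (algebraMap ℤ ℚ) p, HeightOneSpectrum.valuation_of_algebraMap,
      v.intValuation_singleton hpZ.ne_zero rfl]
  rw [← map_natCast (algebraMap ℚ F), ← HeightOneSpectrum.valuation_liesOver F v w, hv,
    ← WithZero.exp_nsmul, nsmul_eq_mul, mul_neg_one]

theorem exists_valuation_eq_exp_neg [NumberField F] {f : F} (hf : f ≠ 0) :
    ∃ a : ℤ, w.valuation F f = WithZero.exp (-a) :=
  ⟨-WithZero.log (w.valuation F f), by
    rw [neg_neg, WithZero.exp_log ((Valuation.ne_zero_iff _).mpr hf)]⟩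

end NumberField

variable {L : Type} [Field L] {P : PrimeSpectrum (𝓞 L)}

section Below

variable (F : Type) [Field F] [NumberField F] [Algebra F L]

/-- The prime of a number field `F` below a non-zero prime of an algebraic extension of `F`. -/
def primeBelow (hP : P.asIdeal ≠ ⊥) : HeightOneSpectrum (𝓞 F) where
  asIdeal := P.asIdeal.comap (algebraMap (𝓞 F) (𝓞 L))
  isPrime := Ideal.comap_isPrime _ _
  ne_bot := Ideal.IsIntegral.comap_ne_bot _ hP

variable {F}

theorem algebraMap_mem_localRing_iff (hP : P.asIdeal ≠ ⊥) {f : F} :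
    algebraMap F L f ∈ localRing (𝓞 L) L P ↔ (primeBelow F hP).valuation F f ≤ 1 := by
  constructor
  · rintro ⟨a, b, hb, h⟩
    by_contra! hf
    have hf0 : f ≠ 0 := fun h0 => by simp [h0] at hf
    obtain ⟨n, ⟨d, hd⟩, hnd⟩ := (primeBelow F hP).exists_primeCompl_mul_eq_of_integer f⁻¹ <| by
      rw [map_inv₀]
      exact inv_le_one_of_one_le₀ hf.le
    have hn : n ∈ (primeBelow F hP).asIdeal := by
      refine (HeightOneSpectrum.valuation_lt_one_iff_mem (K := F) _ n).mp ?_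
      change (primeBelow F hP).valuation F (algebraMap (𝓞 F) F n) < 1
      rw [← hnd, map_mul, map_inv₀, (HeightOneSpectrum.valuation_eq_one_iff_notMem _).mpr hd,
        mul_one]
      exact inv_lt_one_of_one_lt₀ hf
    have hmul : a * algebraMap (𝓞 F) (𝓞 L) n = b * algebraMap (𝓞 F) (𝓞 L) d := by
      have hfn : algebraMap F L f * algebraMap F L (algebraMap (𝓞 F) F n) =
          algebraMap F L (algebraMap (𝓞 F) F d) := by
        rw [← map_mul, ← hnd, mul_inv_cancel_left₀ hf0]
      apply FaithfulSMul.algebraMap_injective (𝓞 L) L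
      rw [map_mul, map_mul, ← h, mul_right_comm, mul_comm]
      exact congrArg _ hfn
    exact P.isPrime.mul_notMem hb hd (hmul ▸ Ideal.mul_mem_left _ a hn)
  · intro hf
    obtain ⟨n, ⟨d, hd⟩, h⟩ := (primeBelow F hP).exists_primeCompl_mul_eq_of_integer f hf
    refine ⟨algebraMap (𝓞 F) (𝓞 L) n, algebraMap (𝓞 F) (𝓞 L) d, hd, ?_⟩
    exact (map_mul (algebraMap F L) _ _).symm.trans (congrArg _ h)

end Below

variable {p : ℕ}

theorem natCast_mem_primeBelow {F : Type} [Field F] [NumberField F] [Algebra F L]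
    (hP : P.asIdeal ≠ ⊥) (hpP : (p : 𝓞 L) ∈ P.asIdeal) :
    (p : 𝓞 F) ∈ (primeBelow F hP).asIdeal := by
  change algebraMap (𝓞 F) (𝓞 L) p ∈ P.asIdeal
  rwa [map_natCast]

variable [CharZero L]

theorem asIdeal_ne_bot_of_natCast_mem (hp : p ≠ 0) (hpP : (p : 𝓞 L) ∈ P.asIdeal) :
    P.asIdeal ≠ ⊥ := by
  intro h
  rw [h, Ideal.mem_bot, Nat.cast_eq_zero] at hpP
  exact hp hpP

variable [Algebra.IsAlgebraic ℚ L]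

theorem numberField_adjoin_simple (f : L) : NumberField ℚ⟮f⟯ where
  to_finiteDimensional := adjoin.finiteDimensional (Algebra.IsIntegral.isIntegral f)

variable [IsFractionRing (𝓞 L) L]

variable (P) in
/-- The local ring at a prime of the integers of an algebraic extension of `ℚ`, as a valuation
ring. -/
noncomputable def localValuationSubring : ValuationSubring L where
  toSubring := localSubring (𝓞 L) L P
  mem_or_inv_mem' f := by
    change f ∈ localRing (𝓞 L) L P ∨ f⁻¹ ∈ localRing (𝓞 L) L P
    by_cases hP : P.asIdeal = ⊥
    · exact Or.inl (mem_localRing_of_asIdeal_eq_bot hP f)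
    have := numberField_adjoin_simple f
    have hgen : f = algebraMap ℚ⟮f⟯ L (AdjoinSimple.gen ℚ f) := rfl
    rw [hgen, ← map_inv₀, algebraMap_mem_localRing_iff hP, algebraMap_mem_localRing_iff hP,
      map_inv₀]
    exact (le_total _ 1).imp_right inv_le_one_of_one_le₀

theorem valuation_le_one_iff {f : L} :
    (localValuationSubring P).valuation f ≤ 1 ↔ f ∈ localRing (𝓞 L) L P :=
  (localValuationSubring P).valuation_le_one_iff f

theorem isEquiv_comap_valuation {F : Type} [Field F] [NumberField F] [Algebra F L]
    (hP : P.asIdeal ≠ ⊥) :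
    ((localValuationSubring P).valuation.comap (algebraMap F L)).IsEquiv
      ((primeBelow F hP).valuation F) :=
  Valuation.isEquiv_of_val_le_one fun f => by
    rw [Valuation.comap_apply, valuation_le_one_iff, algebraMap_mem_localRing_iff hP]

variable {c : ℚ} {w : AddValuation L (WithTop ℚ)}

theorem isRatLog_of_valuation_eq {F : Type} [Field F] [NumberField F] [Algebra F L]
    (hp : p.Prime) (hpP : (p : 𝓞 L) ∈ P.asIdeal) (hP : P.asIdeal ≠ ⊥) {f : F} {a : ℤ}
    (hf : (primeBelow F hP).valuation F f = WithZero.exp (-a)) :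
    IsRatLog ((localValuationSubring P).valuation p)
      ((localValuationSubring P).valuation (algebraMap F L f))
      (a / (primeBelow F hP).asIdeal.ramificationIdx ℤ) := by
  set e := (primeBelow F hP).asIdeal.ramificationIdx ℤ
  obtain ⟨he, hvp⟩ := valuation_natCast_prime hp (natCast_mem_primeBelow (F := F) hP hpP)
  have hfp : (localValuationSubring P).valuation.comap (algebraMap F L) (f ^ e) =
      (localValuationSubring P).valuation.comap (algebraMap F L) (p ^ a) := by
    rw [(isEquiv_comap_valuation hP).eq_iff, map_pow, map_zpow₀, hf, hvp, ← WithZero.exp_nsmul,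
      ← WithZero.exp_zsmul, nsmul_eq_mul, smul_eq_mul, mul_neg, mul_neg, mul_comm]
  rw [map_pow, map_zpow₀, Valuation.comap_apply, Valuation.comap_apply, map_natCast] at hfp
  exact (isRatLog_iff_of_mul_eq he (div_mul_cancel₀ _ (Nat.cast_ne_zero.mpr he))).mpr hfp

theorem exists_isRatLog (hp : p.Prime) (hpP : (p : 𝓞 L) ∈ P.asIdeal) {f : L} (hf : f ≠ 0) :
    ∃ r, IsRatLog ((localValuationSubring P).valuation p)
      ((localValuationSubring P).valuation f) r := by
  have hP := asIdeal_ne_bot_of_natCast_mem hp.ne_zero hpP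
  have := numberField_adjoin_simple f
  have hgen : AdjoinSimple.gen ℚ f ≠ 0 := fun h => hf (congrArg Subtype.val h)
  obtain ⟨a, ha⟩ := exists_valuation_eq_exp_neg (w := primeBelow ℚ⟮f⟯ hP) hgen
  exact ⟨_, isRatLog_of_valuation_eq hp hpP hP ha⟩

theorem map_algebraMap_eq {F : Type} [Field F] [NumberField F] [Algebra F L]
    (hp : p.Prime) (hpP : (p : 𝓞 L) ∈ P.asIdeal) (hP : P.asIdeal ≠ ⊥) (hw : HasLocalRing w P)
    (hwp : w p = c) {f : F} {a : ℤ}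
    (hf : (primeBelow F hP).valuation F f = WithZero.exp (-a)) :
    w (algebraMap F L f) = (a / (primeBelow F hP).asIdeal.ramificationIdx ℤ * c : ℚ) := by
  refine map_eq_of_isRatLog (fun g => (hw g).trans valuation_le_one_iff.symm) hwp ?_
    (isRatLog_of_valuation_eq hp hpP hP hf)
  exact (map_ne_zero _).mpr ((Valuation.ne_zero_iff _).mp (hf ▸ WithZero.exp_ne_zero))

theorem existsUnique_hasLocalRing (hp : p.Prime) (hpP : (p : 𝓞 L) ∈ P.asIdeal) (hc : 0 < c) :
    ∃! w : AddValuation L (WithTop ℚ), HasLocalRing w P ∧ w p = c := by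
  have hp0 : (p : L) ≠ 0 := Nat.cast_ne_zero.mpr hp.ne_zero
  have hp1 : (localValuationSubring P).valuation p < 1 := by
    have hP := asIdeal_ne_bot_of_natCast_mem hp.ne_zero hpP
    rw [← map_natCast (algebraMap ℚ L), ← Valuation.comap_apply,
      (isEquiv_comap_valuation hP).lt_one_iff_lt_one, ← map_natCast (algebraMap (𝓞 ℚ) ℚ),
      HeightOneSpectrum.valuation_lt_one_iff_mem]
    exact natCast_mem_primeBelow hP hpP
  obtain ⟨w, hw, hwp⟩ :=
    exists_addValuation_of_isRatLog hp0 hp1 (fun f => exists_isRatLog hp hpP) hc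
  refine ⟨w, ⟨fun f => (hw f).trans valuation_le_one_iff, hwp⟩, fun w' ⟨hw', hwp'⟩ => ?_⟩
  ext f
  rcases eq_or_ne f 0 with rfl | hf
  · rw [w.map_zero, w'.map_zero]
  obtain ⟨r, hr⟩ := exists_isRatLog hp hpP hf
  rw [map_eq_of_isRatLog hw hwp hf hr,
    map_eq_of_isRatLog (fun g => (hw' g).trans valuation_le_one_iff.symm) hwp' hf hr]

end IntegralClosure

/-! ### Value groups over `ℚ^cyc` -/

section Cyclotomic

open NumberField IntermediateField

/-- The standard primitive `n`-th root of unity in `ℚ^cyc`. -/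
noncomputable def zetaCyc (n : ℕ) [NeZero n] : Qcyc :=
  ⟨Complex.exp (2 * Real.pi * Complex.I / n), subset_adjoin _ _
    ⟨n, NeZero.pos n, (Complex.isPrimitiveRoot_exp n (NeZero.ne n)).pow_eq_one⟩⟩

theorem isPrimitiveRoot_zetaCyc (n : ℕ) [NeZero n] : IsPrimitiveRoot (zetaCyc n) n :=
  .of_map_of_injective (f := algebraMap Qcyc ℂ)
    (Complex.isPrimitiveRoot_exp n (NeZero.ne n)) (algebraMap Qcyc ℂ).injective

theorem mem_adjoin_zetaCyc_of_pow_eq_one {n : ℕ} [NeZero n] {z : Qcyc} (hz : z ^ n = 1) :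
    z ∈ ℚ⟮zetaCyc n⟯ := by
  obtain ⟨i, -, rfl⟩ := (isPrimitiveRoot_zetaCyc n).eq_pow_of_pow_eq_one hz
  exact pow_mem (mem_adjoin_simple_self ℚ _) i

theorem adjoin_zetaCyc_le {m n : ℕ} [NeZero m] [NeZero n] (h : m ∣ n) :
    ℚ⟮zetaCyc m⟯ ≤ ℚ⟮zetaCyc n⟯ :=
  adjoin_simple_le_iff.mpr <| mem_adjoin_zetaCyc_of_pow_eq_one <|
    ((isPrimitiveRoot_zetaCyc m).pow_eq_one_iff_dvd n).mpr h

theorem exists_mem_adjoin_zetaCyc (f : Qcyc) : ∃ (n : ℕ) (_ : NeZero n), f ∈ ℚ⟮zetaCyc n⟯ := by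
  obtain ⟨z, hz⟩ := f
  induction hz using adjoin_induction with
  | mem x hx =>
    obtain ⟨n, hn, h⟩ := hx
    have : NeZero n := ⟨hn.ne'⟩
    exact ⟨n, this, mem_adjoin_zetaCyc_of_pow_eq_one (Subtype.ext h)⟩
  | algebraMap x => exact ⟨1, ⟨one_ne_zero⟩, _root_.algebraMap_mem ℚ⟮zetaCyc 1⟯ x⟩
  | add x y hx hy h₁ h₂ =>
    obtain ⟨m, hm, h₁⟩ := h₁
    obtain ⟨n, hn, h₂⟩ := h₂
    exact ⟨m * n, inferInstance, add_mem (adjoin_zetaCyc_le (Dvd.intro _ rfl) h₁)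
      (adjoin_zetaCyc_le (Dvd.intro_left _ rfl) h₂)⟩
  | inv x hx h => exact h.imp fun n ⟨hn, h⟩ => ⟨hn, inv_mem h⟩
  | mul x y hx hy h₁ h₂ =>
    obtain ⟨m, hm, h₁⟩ := h₁
    obtain ⟨n, hn, h₂⟩ := h₂
    exact ⟨m * n, inferInstance, mul_mem (adjoin_zetaCyc_le (Dvd.intro _ rfl) h₁)
      (adjoin_zetaCyc_le (Dvd.intro_left _ rfl) h₂)⟩

theorem isCyclotomicExtension_adjoin_zetaCyc (n : ℕ) [NeZero n] :
    IsCyclotomicExtension {n} ℚ ℚ⟮zetaCyc n⟯ :=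
  (isPrimitiveRoot_zetaCyc n).intermediateField_adjoin_isCyclotomicExtension ℚ

theorem exists_isCyclotomicExtension_mem {p : ℕ} (hp : p.Prime) (f : Qcyc) :
    ∃ (k m : ℕ) (F : IntermediateField ℚ Qcyc), ¬ p ∣ m ∧
      IsCyclotomicExtension {p ^ (k + 1) * m} ℚ F ∧ f ∈ F := by
  obtain ⟨n, hn, hf⟩ := exists_mem_adjoin_zetaCyc f
  obtain ⟨k, m, hm, rfl⟩ := Nat.exists_eq_pow_mul_and_not_dvd (NeZero.ne n) p hp.ne_one
  have : NeZero p := ⟨hp.ne_zero⟩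
  have : NeZero m := ⟨fun h => hm (h ▸ dvd_zero p)⟩
  exact ⟨k, m, _, hm, isCyclotomicExtension_adjoin_zetaCyc _,
    adjoin_zetaCyc_le (mul_dvd_mul_right (pow_dvd_pow p k.le_succ) m) hf⟩

theorem associated_sub_one_pow_natCast {A : Type*} [CommRing A] [IsDomain A] {p k : ℕ} {ζ : A}
    (hp : p.Prime) (hζ : IsPrimitiveRoot ζ (p ^ (k + 1))) :
    Associated ((ζ - 1) ^ (p ^ k * (p - 1))) (p : A) := by
  have := Fact.mk hp
  have hcard : (primitiveRoots (p ^ (k + 1)) A).card = p ^ k * (p - 1) := by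
    rw [hζ.card_primitiveRoots, Nat.totient_prime_pow_succ hp]
  rw [← Polynomial.eval_one_cyclotomic_prime_pow k,
    Polynomial.cyclotomic_eq_prod_X_sub_primitiveRoots hζ, Polynomial.eval_prod, ← hcard,
    ← Finset.prod_const]
  refine Associated.prod _ _ _ fun η hη => ?_
  obtain ⟨i, -, hi, rfl⟩ := hζ.isPrimitiveRoot_iff.mp (isPrimitiveRoot_of_mem_primitiveRoots hη)
  rw [Polynomial.eval_sub, Polynomial.eval_X, Polynomial.eval_C, ← neg_sub _ (1 : A)]
  exact (hζ.associated_sub_one_pow_sub_one_of_coprime hi).neg_right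

theorem IsNormalizedValuation.map_eq_one_div_of_associated {p k : ℕ} {P : PrimeSpectrum Ocyc}
    {v : AddValuation Qcyc (WithTop ℚ)} (hv : IsNormalizedValuation p P v) (hp : p.Prime)
    {z : Ocyc} (hz : Associated (z ^ (p ^ k * (p - 1))) (p : Ocyc)) :
    v (algebraMap Ocyc Qcyc z) = (1 / p ^ k : ℚ) := by
  have hvz : (p ^ k * (p - 1)) • v (algebraMap Ocyc Qcyc z) = ((p - 1 : ℚ) : WithTop ℚ) := by
    rw [← v.map_pow, ← map_pow, HasLocalRing.map_eq_of_associated hv.nonneg_iff hz, map_natCast,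
      hv.map_prime]
  have hp1 : (p : ℚ) - 1 ≠ 0 := sub_ne_zero.mpr (Nat.cast_ne_one.mpr hp.ne_one)
  have hpk : (p : ℚ) ^ k ≠ 0 := pow_ne_zero k (Nat.cast_ne_zero.mpr hp.ne_zero)
  cases hr : v (algebraMap Ocyc Qcyc z) with
  | top =>
    obtain ⟨n, hn⟩ := Nat.exists_eq_succ_of_ne_zero
      (mul_ne_zero (pow_ne_zero k hp.ne_zero) (Nat.sub_ne_zero_of_lt hp.one_lt))
    rw [hr, hn, succ_nsmul, WithTop.add_top] at hvz
    exact absurd hvz WithTop.top_ne_coe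
  | coe r =>
    rw [hr, ← WithTop.coe_nsmul, WithTop.coe_inj, nsmul_eq_mul, Nat.cast_mul, Nat.cast_pow,
      Nat.cast_pred hp.pos] at hvz
    rw [WithTop.coe_inj, eq_div_iff hpk]
    exact mul_right_cancel₀ hp1 (by linear_combination hvz)

theorem exists_forall_isNormalizedValuation_map_eq {p : ℕ} (hp : p.Prime) {r : ℚ}
    (hr : r ∈ fractionGroup p) :
    ∃ g : Qcycˣ, (∀ P v, IsNormalizedValuation p P v → v g = r) ∧
      ∀ P : PrimeSpectrum Ocyc, (p : Ocyc) ∉ P.asIdeal → g ∈ localUnits Ocyc Qcyc P := by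
  have : NeZero p := ⟨hp.ne_zero⟩
  obtain ⟨k, a, hr⟩ := hr
  obtain ⟨z, hz⟩ : ∃ z : Ocyc, Associated (z ^ (p ^ k * (p - 1))) (p : Ocyc) :=
    ⟨_, associated_sub_one_pow_natCast hp
      (isPrimitiveRoot_zetaCyc (p ^ (k + 1))).toInteger_isPrimitiveRoot⟩
  have he : p ^ k * (p - 1) ≠ 0 :=
    mul_ne_zero (pow_ne_zero k hp.ne_zero) (Nat.sub_ne_zero_of_lt hp.one_lt)
  have hz0 : z ≠ 0 := by
    rintro rfl
    rw [zero_pow he] at hz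
    exact Nat.cast_ne_zero.mpr hp.ne_zero ((associated_zero_iff_eq_zero _).mp hz.symm)
  let u : Qcycˣ := .mk0 (algebraMap Ocyc Qcyc z) (by rwa [Ne, FaithfulSMul.algebraMap_eq_zero_iff])
  refine ⟨u ^ a, fun P v hv => ?_, fun P hP => zpow_mem ?_ a⟩
  · rw [Units.val_zpow_eq_zpow_val]
    refine (map_zpow_of_eq (hv.map_eq_one_div_of_associated hp hz) a).trans ?_
    rw [← hr, mul_one_div, mul_div_cancel_right₀ _
      (pow_ne_zero k (Nat.cast_ne_zero.mpr hp.ne_zero))]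
  · have hzP : z ∉ P.asIdeal := fun h => hP <|
      P.asIdeal.mem_of_dvd hz.dvd (Ideal.pow_mem_of_mem _ h _ (Nat.pos_of_ne_zero he))
    exact mem_localUnits_of_notMem hzP rfl

section CyclotomicExtension

variable {p k m : ℕ} {F : Type} [Field F] [NumberField F]
  [IsCyclotomicExtension {p ^ (k + 1) * m} ℚ F] [Algebra F Qcyc]
  {P : PrimeSpectrum Ocyc} {v : AddValuation Qcyc (WithTop ℚ)}

theorem IsNormalizedValuation.map_algebraMap (hv : IsNormalizedValuation p P v) (hp : p.Prime)
    (hpP : (p : Ocyc) ∈ P.asIdeal) (hP : P.asIdeal ≠ ⊥) (hm : ¬ p ∣ m) {f : F} {a : ℤ}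
    (hf : (primeBelow F hP).valuation F f = WithZero.exp (-a)) :
    v (algebraMap F Qcyc f) = (a / p ^ k : ℚ) := by
  have := Fact.mk hp
  have := liesOver_span_of_mem hp (natCast_mem_primeBelow (F := F) hP hpP)
  have he : (primeBelow F hP).asIdeal.ramificationIdx ℤ = p ^ k * (p - 1) :=
    IsCyclotomicExtension.Rat.ramificationIdx_eq _ F _ rfl hm
  refine (map_algebraMap_eq hp hpP hP hv.nonneg_iff hv.map_prime hf).trans ?_
  rw [he, Nat.cast_mul, Nat.cast_pow, Nat.cast_pred hp.pos, div_mul_eq_mul_div, mul_div_mul_right]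
  exact sub_ne_zero.mpr (Nat.cast_ne_one.mpr hp.ne_one)

end CyclotomicExtension

variable {p : ℕ} {P : PrimeSpectrum Ocyc} {v : AddValuation Qcyc (WithTop ℚ)}

namespace IsNormalizedValuation

theorem exists_mem_fractionGroup (hv : IsNormalizedValuation p P v) (hp : p.Prime)
    (hpP : (p : Ocyc) ∈ P.asIdeal) {f : Qcyc} (hf : f ≠ 0) :
    ∃ r ∈ fractionGroup p, v f = r := by
  have hP := asIdeal_ne_bot_of_natCast_mem hp.ne_zero hpP
  obtain ⟨k, m, F, hm, hF, hfF⟩ := exists_isCyclotomicExtension_mem hp f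
  have : NumberField F := IsCyclotomicExtension.numberField {p ^ (k + 1) * m} ℚ F
  have hf' : (⟨f, hfF⟩ : F) ≠ 0 := fun h => hf (congrArg Subtype.val h)
  obtain ⟨a, ha⟩ := exists_valuation_eq_exp_neg (w := primeBelow F hP) hf'
  exact ⟨a / p ^ k, ⟨k, a, div_mul_cancel₀ _ (pow_ne_zero k (Nat.cast_ne_zero.mpr hp.ne_zero))⟩,
    hv.map_algebraMap hp hpP hP hm ha⟩

theorem setOf_map_eq_coe (hv : IsNormalizedValuation p P v) (hp : p.Prime)
    (hpP : (p : Ocyc) ∈ P.asIdeal) :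
    {r : ℚ | ∃ f : Qcyc, v f = (r : WithTop ℚ)} = fractionGroup p := by
  ext r
  refine ⟨fun ⟨f, hf⟩ => ?_, fun hr => ?_⟩
  · obtain ⟨s, hs, hfs⟩ := hv.exists_mem_fractionGroup hp hpP <|
      v.ne_top_iff.mp (hf ▸ WithTop.coe_ne_top)
    rwa [WithTop.coe_inj.mp (hf.symm.trans hfs)]
  · obtain ⟨g, hg, -⟩ := exists_forall_isNormalizedValuation_map_eq hp hr
    exact ⟨g, hg P v hv⟩

end IsNormalizedValuation

theorem existsUnique_isNormalizedValuation (hp : p.Prime) (hpP : (p : Ocyc) ∈ P.asIdeal) :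
    ∃! v : AddValuation Qcyc (WithTop ℚ), IsNormalizedValuation p P v := by
  have hc : (0 : ℚ) < p - 1 := sub_pos.mpr (Nat.one_lt_cast.mpr hp.one_lt)
  refine (existsUnique_congr fun v => ?_).mp (existsUnique_hasLocalRing hp hpP hc)
  exact ⟨fun ⟨h, h'⟩ => ⟨h, h'⟩, fun ⟨h, h'⟩ => ⟨h, h'⟩⟩

end Cyclotomic

/-! ### Tropical hyperrings -/

/-- The maximum of `a`, `b`, `c` is attained at least twice. -/
def MaxTwice {α : Type} [LinearOrder α] (a b c : α) : Prop :=
  a ≤ max b c ∧ b ≤ max a c ∧ c ≤ max a b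

namespace MaxTwice

variable {α β : Type} [LinearOrder α] [LinearOrder β] {a b c d : α}

theorem iff_ne_and_eq_max_or_eq_and_le :
    MaxTwice a b c ↔ (a ≠ b ∧ c = max a b) ∨ (a = b ∧ c ≤ a) := by
  unfold MaxTwice
  grind

theorem map {f : α → β} (hf : Monotone f) (h : MaxTwice a b c) :
    MaxTwice (f a) (f b) (f c) := by
  simp only [MaxTwice, ← hf.map_max]
  exact ⟨hf h.1, hf h.2.1, hf h.2.2⟩

theorem map_iff {f : α → β} (hf : StrictMono f) :
    MaxTwice (f a) (f b) (f c) ↔ MaxTwice a b c := by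
  simp only [MaxTwice, ← hf.monotone.map_max, hf.le_iff_le]

theorem swap_left (h : MaxTwice a b c) : MaxTwice b a c :=
  ⟨h.2.1, h.1, max_comm a b ▸ h.2.2⟩

theorem swap_right (h : MaxTwice a b c) : MaxTwice a c b :=
  ⟨max_comm b c ▸ h.1, h.2.2, h.2.1⟩

theorem bot_middle_iff [OrderBot α] : MaxTwice a ⊥ c ↔ c = a := by
  rw [MaxTwice, bot_sup_eq, sup_bot_eq, le_antisymm_iff]
  exact ⟨fun h => ⟨h.2.2, h.1⟩, fun h => ⟨h.2, bot_le, h.1⟩⟩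

theorem bot_right_iff [OrderBot α] : MaxTwice a b ⊥ ↔ b = a :=
  ⟨fun h => bot_middle_iff.mp h.swap_right, fun h => (bot_middle_iff.mpr h).swap_right⟩

/-- Both sides say that the maximum of `a`, `b`, `c`, `d` is attained at least twice. The right
one is symmetric, which makes the hyperaddition associative. -/
theorem exists_mem_iff {V : Set α} (ha : a ∈ V) (hb : b ∈ V) (hc : c ∈ V) (hd : d ∈ V) :
    (∃ t ∈ V, MaxTwice a b t ∧ MaxTwice t c d) ↔
      a ≤ max b (max c d) ∧ b ≤ max a (max c d) ∧ c ≤ max d (max a b) ∧ d ≤ max c (max a b) := by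
  unfold MaxTwice
  refine ⟨fun ⟨t, _, h⟩ => by grind, fun h => ?_⟩
  rcases lt_trichotomy a b with hab | rfl | hab
  · exact ⟨b, hb, by grind⟩
  · rcases le_total (max c d) a with hcd | hcd
    · exact ⟨max c d, by grind, by grind⟩
    · exact ⟨a, ha, by grind⟩
  · exact ⟨a, ha, by grind⟩

end MaxTwice

variable {A B Γ : Type} [AddCommGroup Γ] [LinearOrder Γ]

/-- `val` identifies `h` with the hyperring `S ∪ {-∞}` whose product is the addition of `S`, and
where `z ∈ x + y` means that the maximum of `x`, `y`, `z` is attained at least twice. -/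
structure HyperStr.IsTropical (h : HyperStr A) (S : AddSubgroup Γ) (val : A → WithBot Γ) :
    Prop where
  injective : Function.Injective val
  exists_val_eq_coe_iff : ∀ r : Γ, (∃ a, val a = r) ↔ r ∈ S
  val_zero : val h.zero = ⊥
  val_one : val h.one = 0
  mul_iff : ∀ x y z, h.mul x y z ↔ val z = val x + val y
  add_iff : ∀ x y z, h.add x y z ↔ MaxTwice (val x) (val y) (val z)

namespace HyperStr.IsTropical

variable {h : HyperStr A} {h' : HyperStr B} {S : AddSubgroup Γ} {val : A → WithBot Γ}
  {val' : B → WithBot Γ}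

theorem mem_of_val_eq (H : h.IsTropical S val) {x : A} {r : Γ} (hx : val x = r) : r ∈ S :=
  (H.exists_val_eq_coe_iff r).mp ⟨x, hx⟩

theorem exists_val_eq_add (H : h.IsTropical S val) (x y : A) : ∃ z, val z = val x + val y := by
  cases hx : val x with
  | bot => exact ⟨x, by rw [hx, WithBot.bot_add]⟩
  | coe a =>
    cases hy : val y with
    | bot => exact ⟨y, by rw [hy, WithBot.add_bot]⟩
    | coe b =>
      exact (H.exists_val_eq_coe_iff _).mpr (S.add_mem (H.mem_of_val_eq hx) (H.mem_of_val_eq hy))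

theorem exists_val_add_eq (H : h.IsTropical S val) {x : A} (hx : val x ≠ ⊥) (y : A) :
    ∃ z, val x + val z = val y := by
  obtain ⟨a, ha⟩ := WithBot.ne_bot_iff_exists.mp hx
  cases hy : val y with
  | bot => exact ⟨y, by rw [hy, WithBot.add_bot]⟩
  | coe b =>
    obtain ⟨z, hz⟩ := (H.exists_val_eq_coe_iff _).mpr
      (S.sub_mem (H.mem_of_val_eq hy) (H.mem_of_val_eq ha.symm))
    exact ⟨z, by rw [hz, ← ha, ← WithBot.coe_add, add_sub_cancel]⟩

theorem exists_add (H : h.IsTropical S val) (x y : A) : ∃ z, h.add x y z := by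
  rcases le_total (val x) (val y) with hxy | hxy
  · exact ⟨y, (H.add_iff x y y).mpr ⟨le_max_of_le_left hxy, le_max_right _ _, le_max_right _ _⟩⟩
  · exact ⟨x, (H.add_iff x y x).mpr ⟨le_max_right _ _, le_max_of_le_left hxy, le_max_left _ _⟩⟩

theorem add_comm_iff (H : h.IsTropical S val) {x y z : A} : h.add x y z ↔ h.add y x z := by
  rw [H.add_iff, H.add_iff]
  exact ⟨.swap_left, .swap_left⟩

theorem add_zero_iff (H : h.IsTropical S val) {x y : A} : h.add x y h.zero ↔ y = x := by
  rw [H.add_iff, H.val_zero, MaxTwice.bot_right_iff, H.injective.eq_iff]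

theorem exists_add_add_iff (H : h.IsTropical S val) (x y z w : A) :
    (∃ t, h.add x y t ∧ h.add t z w) ↔ ∃ t, h.add y z t ∧ h.add x t w := by
  have key (x y z w : A) : (∃ t, h.add x y t ∧ h.add t z w) ↔
      ∃ t ∈ Set.range val, MaxTwice (val x) (val y) t ∧ MaxTwice t (val z) (val w) := by
    simp only [H.add_iff, Set.exists_range_iff]
  have hV : ∀ a, val a ∈ Set.range val := Set.mem_range_self
  simp only [H.add_comm_iff (x := x) (y := _) (z := w)]
  rw [key, key, MaxTwice.exists_mem_iff (hV x) (hV y) (hV z) (hV w),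
    MaxTwice.exists_mem_iff (hV y) (hV z) (hV x) (hV w)]
  grind

theorem range_eq (H : h.IsTropical S val) (H' : h'.IsTropical S val') :
    Set.range val = Set.range val' := by
  ext t
  cases t with
  | bot => exact iff_of_true ⟨_, H.val_zero⟩ ⟨_, H'.val_zero⟩
  | coe r => exact (H.exists_val_eq_coe_iff r).trans (H'.exists_val_eq_coe_iff r).symm

/-- Two hyperrings identified with the same `S ∪ {-∞}` are in bijection. -/
noncomputable def equiv (H : h.IsTropical S val) (H' : h'.IsTropical S val') : A ≃ B :=
  (Equiv.ofInjective val H.injective).trans <|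
    (Equiv.setCongr (H.range_eq H')).trans (Equiv.ofInjective val' H'.injective).symm

theorem val_equiv (H : h.IsTropical S val) (H' : h'.IsTropical S val') (a : A) :
    val' (H.equiv H' a) = val a :=
  Equiv.apply_ofInjective_symm H'.injective _

variable [IsOrderedAddMonoid Γ]

theorem add_mul_iff (H : h.IsTropical S val) {r x y a b w : A} (ha : h.mul r x a)
    (hb : h.mul r y b) : h.add a b w ↔ ∃ z, h.add x y z ∧ h.mul r z w := by
  rw [H.mul_iff] at ha hb
  simp only [H.add_iff, H.mul_iff, ha, hb]
  by_cases hr : val r = ⊥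
  · simp only [hr, WithBot.bot_add, MaxTwice.bot_middle_iff, ← H.add_iff]
    exact ⟨fun hw => (H.exists_add x y).imp fun z hz => ⟨hz, hw⟩, fun ⟨_, _, hw⟩ => hw⟩
  have hmono : StrictMono (val r + ·) := fun _ _ => WithBot.add_lt_add_left hr
  constructor
  · intro hw
    obtain ⟨z, hz⟩ := H.exists_val_add_eq hr w
    exact ⟨z, (MaxTwice.map_iff hmono).mp (hz ▸ hw), hz.symm⟩
  · rintro ⟨z, hz, hw⟩
    exact hw ▸ (MaxTwice.map_iff hmono).mpr hz

theorem isHyperring (H : h.IsTropical S val) : h.IsHyperring where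
  add_nonempty := H.exists_add
  add_comm _ _ _ := H.add_comm_iff.mp
  add_zero x z := by rw [H.add_iff, H.val_zero, MaxTwice.bot_middle_iff, H.injective.eq_iff]
  add_assoc := H.exists_add_add_iff
  exists_unique_neg x := ⟨x, H.add_zero_iff.mpr rfl, fun _ => H.add_zero_iff.mp⟩
  reversible x x' y z h0 hz := by
    obtain rfl := H.add_zero_iff.mp h0
    exact (H.add_iff _ _ _).mpr ((H.add_iff _ _ _).mp hz).swap_right.swap_left
  mul_existsUnique x y := by
    obtain ⟨z, hz⟩ := H.exists_val_eq_add x y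
    exact ⟨z, (H.mul_iff _ _ _).mpr hz,
      fun w hw => H.injective (((H.mul_iff _ _ _).mp hw).trans hz.symm)⟩
  mul_comm x y z hz := by rwa [H.mul_iff, add_comm, ← H.mul_iff]
  mul_assoc x y z a b w ha hb := by
    rw [H.mul_iff] at ha hb
    rw [H.mul_iff, H.mul_iff, ha, hb, add_assoc]
  mul_one x := by rw [H.mul_iff, H.val_one, add_zero]
  mul_zero x := by rw [H.mul_iff, H.val_zero, WithBot.add_bot]
  distrib _ _ _ _ _ _ := H.add_mul_iff
  zero_ne_one e := by
    have hval := congrArg val e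
    rw [H.val_zero, H.val_one] at hval
    exact WithBot.bot_ne_coe hval

end HyperStr.IsTropical

/-! ### The stalks of the inverse image of the structure sheaf -/

theorem prime_eq_of_mem_asIdeal {q : PrimeSpectrum ℤ} {p p' : ℕ} (hp : p.Prime) (hp' : p'.Prime)
    (h : (p : ℤ) ∈ q.asIdeal) (h' : (p' : ℤ) ∈ q.asIdeal) : p = p' := by
  by_contra hne
  obtain ⟨a, b, hab⟩ := Nat.isCoprime_iff_coprime.mpr ((Nat.coprime_primes hp hp').mpr hne)
  exact q.isPrime.ne_top <| (Ideal.eq_top_iff_one _).mpr <|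
    hab ▸ add_mem (Ideal.mul_mem_left _ a h) (Ideal.mul_mem_left _ b h')

/-- The group of differences of elements of the stalk of `𝒮` at `q`: it is `H(p)` at the prime
`p` and zero at the generic point. -/
def valueGroup (q : PrimeSpectrum ℤ) : AddSubgroup ℚ where
  carrier := {x | x = 0 ∨ ∃ p : ℕ, p.Prime ∧ (p : ℤ) ∈ q.asIdeal ∧ x ∈ fractionGroup p}
  zero_mem' := Or.inl rfl
  add_mem' := by
    rintro x y (rfl | ⟨p, hp, hq, hx⟩) hy
    · rwa [zero_add]
    · rcases hy with rfl | ⟨p', hp', hq', hy⟩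
      · rw [add_zero]
        exact Or.inr ⟨p, hp, hq, hx⟩
      · obtain rfl := prime_eq_of_mem_asIdeal hp hp' hq hq'
        exact Or.inr ⟨p, hp, hq, add_mem hx hy⟩
  neg_mem' := by
    rintro x (rfl | ⟨p, hp, hq, hx⟩)
    · exact Or.inl neg_zero
    · exact Or.inr ⟨p, hp, hq, neg_mem hx⟩

theorem mem_valueGroup_iff {q : PrimeSpectrum ℤ} {p : ℕ} (hp : p.Prime)
    (hq : (p : ℤ) ∈ q.asIdeal) {x : ℚ} : x ∈ valueGroup q ↔ x ∈ fractionGroup p := by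
  refine ⟨?_, fun h => Or.inr ⟨p, hp, hq, h⟩⟩
  rintro (rfl | ⟨p', hp', hq', h⟩)
  · exact zero_mem _
  · rwa [prime_eq_of_mem_asIdeal hp hp' hq hq']

theorem mem_valueGroup_iff_of_forall_notMem {q : PrimeSpectrum ℤ}
    (hq : ∀ p : ℕ, p.Prime → (p : ℤ) ∉ q.asIdeal) {x : ℚ} : x ∈ valueGroup q ↔ x = 0 :=
  ⟨fun h => h.resolve_right fun ⟨p, hp, h, _⟩ => hq p hp h, Or.inl⟩

theorem eventually_mul_pow_eq_natCast {p : ℕ} {d : ℚ} (h0 : 0 ≤ d) (hd : d ∈ fractionGroup p) :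
    ∀ᶠ k in Filter.atTop, ∃ n : ℕ, d * p ^ k = n := by
  obtain ⟨i, m, hm⟩ := hd
  lift m to ℕ using by exact_mod_cast hm ▸ mul_nonneg h0 (pow_nonneg p.cast_nonneg i)
  filter_upwards [Filter.eventually_ge_atTop i] with k hk
  obtain ⟨j, rfl⟩ := Nat.exists_eq_add_of_le hk
  exact ⟨m * p ^ j, by rw [pow_add, ← mul_assoc, hm, Nat.cast_mul, Nat.cast_pow, Int.cast_natCast]⟩

/-- Multiplication by `c`, as a map from `ℤ ∪ {-∞}` to `ℚ ∪ {-∞}`. -/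
def scaleBot (c : ℚ) : WithBot ℤ → WithBot ℚ := WithBot.map fun m : ℤ => (m : ℚ) * c

/-- A section of `scaleBot c` on its range. For `c = 0` the range is `{-∞, 0}`, on which
`r / c` has the correct value `0`. -/
def floorBot (c : ℚ) : WithBot ℚ → WithBot ℤ := WithBot.map fun r : ℚ => ⌊r / c⌋

section Scale

variable {c : ℚ} {v w : WithBot ℚ}

theorem monotone_scaleBot (hc : 0 ≤ c) : Monotone (scaleBot c) :=
  Monotone.withBot_map fun _ _ h => mul_le_mul_of_nonneg_right (Int.cast_le.mpr h) hc

theorem monotone_floorBot (hc : 0 ≤ c) : Monotone (floorBot c) :=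
  Monotone.withBot_map fun _ _ h => Int.floor_mono (div_le_div_of_nonneg_right h hc)

theorem floorBot_scaleBot (hc : c ≠ 0) (x : WithBot ℤ) : floorBot c (scaleBot c x) = x := by
  cases x with
  | bot => rfl
  | coe m =>
    exact congrArg WithBot.some
      (show ⌊(m * c : ℚ) / c⌋ = m by rw [mul_div_cancel_right₀ _ hc, Int.floor_intCast])

theorem scaleBot_add (x y : WithBot ℤ) : scaleBot c (x + y) = scaleBot c x + scaleBot c y := by
  cases x with
  | bot => rfl
  | coe a =>
    cases y with
    | bot => rfl
    | coe b =>
      exact congrArg WithBot.some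
        (show ((a + b : ℤ) : ℚ) * c = a * c + b * c by rw [Int.cast_add, add_mul])

theorem floorBot_zero_coe (r : ℚ) : floorBot 0 r = 0 :=
  congrArg WithBot.some (show ⌊r / 0⌋ = 0 by rw [div_zero, Int.floor_zero])

theorem floorBot_add (hv : scaleBot c (floorBot c v) = v) (hw : scaleBot c (floorBot c w) = w) :
    floorBot c (v + w) = floorBot c v + floorBot c w := by
  rcases eq_or_ne c 0 with rfl | hc
  · cases v with
    | bot => rfl
    | coe r =>
      cases w with
      | bot => rfl
      | coe s => rw [← WithBot.coe_add, floorBot_zero_coe, floorBot_zero_coe, floorBot_zero_coe,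
          add_zero]
  · nth_rewrite 1 [← hv, ← hw]
    rw [← scaleBot_add, floorBot_scaleBot hc]

end Scale

section Tensor

variable {q : PrimeSpectrum ℤ}

theorem exists_forall_eq_nsmul {T : Set (thetaStalk q)} (hT : T.Finite) :
    ∃ c : thetaStalk q, ∀ d ∈ T, ∃ n : ℕ, d = n • c := by
  by_cases h : ∃ p : ℕ, p.Prime ∧ (p : ℤ) ∈ q.asIdeal
  · obtain ⟨p, hp, hq⟩ := h
    have hp0 (k : ℕ) : (p : ℚ) ^ k ≠ 0 := pow_ne_zero k (Nat.cast_ne_zero.mpr hp.ne_zero)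
    obtain ⟨k, hk⟩ := ((Filter.eventually_all_finite hT).mpr fun d _ =>
      eventually_mul_pow_eq_natCast d.2.1 ((mem_valueGroup_iff hp hq).mp d.2.2)).exists
    refine ⟨⟨((p : ℚ) ^ k)⁻¹, by positivity, Or.inr ⟨p, hp, hq, k, 1, ?_⟩⟩, fun d hd => ?_⟩
    · rw [inv_mul_cancel₀ (hp0 k), Int.cast_one]
    · exact (hk d hd).imp fun n hn => Subtype.ext ((eq_mul_inv_iff_mul_eq₀ (hp0 k)).mpr hn)
  · refine ⟨thetaZero q, fun d _ => ⟨0, Subtype.ext ?_⟩⟩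
    have hd : (d : ℚ) = 0 :=
      (mem_valueGroup_iff_of_forall_notMem fun p hp hq => h ⟨p, hp, hq⟩).mp d.2.2
    rw [hd]
    exact (mul_zero _).symm

/-- The pure tensor `x ⊗ c` in a stalk of `Θ^* ℤ_max`. -/
def stalkTmul (x : WithBot ℤ) (c : thetaStalk q) : MonoidTensor ZMax (thetaStalk q) :=
  MonoidTensor.tmul (A := ZMax) x c

theorem stalkTmul_nsmul (n : ℕ) (x : ZMax) (c : thetaStalk q) :
    stalkTmul x (n • c) = stalkTmul (n • x) c :=
  (Quot.sound (MonoidTensor.Rel.smul n x c)).symm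

theorem stalkTmul_thetaZero (m : ℤ) : stalkTmul m (thetaZero q) = stalkTmul 0 (thetaZero q) := by
  have hc : (0 : ℕ) • thetaZero q = thetaZero q := Subtype.ext (mul_zero _)
  have hm : (0 : ℕ) • (show ZMax from (m : WithBot ℤ)) = (0 : WithBot ℤ) :=
    WithBot.coe_inj.mpr (zero_mul m)
  rw [← hm, ← stalkTmul_nsmul, hc]

theorem stalkTmul_floorBot_stalkValue (x : WithBot ℤ) (c : thetaStalk q) :
    stalkTmul (floorBot c (stalkValue q (stalkTmul x c))) c = stalkTmul x c := by
  change stalkTmul (floorBot c (scaleBot c x)) c = _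
  rcases eq_or_ne (c : ℚ) 0 with hc | hc
  · obtain rfl : c = thetaZero q := Subtype.ext hc
    cases x with
    | bot => rfl
    | coe m =>
      rw [stalkTmul_thetaZero m]
      exact congrArg (stalkTmul · _) (floorBot_zero_coe _)
  · rw [floorBot_scaleBot hc]

theorem exists_stalkTmul_eq₃ (r s t : MonoidTensor ZMax (thetaStalk q)) :
    ∃ c : thetaStalk q, stalkTmul (floorBot c (stalkValue q r)) c = r ∧
      stalkTmul (floorBot c (stalkValue q s)) c = s ∧
      stalkTmul (floorBot c (stalkValue q t)) c = t := by
  obtain ⟨⟨x, a⟩, rfl⟩ := Quot.exists_rep r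
  obtain ⟨⟨y, b⟩, rfl⟩ := Quot.exists_rep s
  obtain ⟨⟨z, d⟩, rfl⟩ := Quot.exists_rep t
  obtain ⟨c, hc⟩ := exists_forall_eq_nsmul (Set.toFinite {a, b, d})
  have key (w : ZMax) {e : thetaStalk q} (he : e ∈ ({a, b, d} : Set (thetaStalk q))) :
      stalkTmul (floorBot c (stalkValue q (stalkTmul w e))) c = stalkTmul w e := by
    obtain ⟨n, rfl⟩ := hc e he
    rw [stalkTmul_nsmul]
    exact stalkTmul_floorBot_stalkValue _ c
  exact ⟨c, key x (Or.inl rfl), key y (Or.inr (Or.inl rfl)), key z (Or.inr (Or.inr rfl))⟩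

theorem stalkValue_injective (q : PrimeSpectrum ℤ) : Function.Injective (stalkValue q) := by
  intro t t' h
  obtain ⟨c, hc, hc', -⟩ := exists_stalkTmul_eq₃ t t' t
  rw [← hc, h, hc']

theorem exists_stalkValue_eq_coe_iff {r : ℚ} : (∃ t, stalkValue q t = r) ↔ r ∈ valueGroup q := by
  constructor
  · rintro ⟨⟨x, c⟩, h⟩
    cases x using WithBot.recBotCoe with
    | bot => exact absurd h WithBot.bot_ne_coe
    | coe m =>
      rw [← show (m : ℚ) * c = r from WithBot.coe_injective h, ← zsmul_eq_mul]
      exact zsmul_mem (show (c : ℚ) ∈ valueGroup q from c.2.2) m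
  · intro hr
    rcases le_total 0 r with h0 | h0
    · exact ⟨stalkTmul (1 : ℤ) ⟨r, h0, hr⟩, WithBot.coe_inj.mpr (by simp)⟩
    · exact ⟨stalkTmul (-1 : ℤ) ⟨-r, neg_nonneg.mpr h0, neg_mem hr⟩,
        WithBot.coe_inj.mpr (by simp)⟩

theorem isTropical_stalkValue (q : PrimeSpectrum ℤ) :
    ((thetaInverseImage ZMax zHmax).str q).IsTropical (valueGroup q) (stalkValue q) where
  injective := stalkValue_injective q
  exists_val_eq_coe_iff _ := exists_stalkValue_eq_coe_iff
  val_zero := rfl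
  val_one := WithBot.coe_inj.mpr (mul_zero _)
  mul_iff r s t := by
    constructor
    · rintro ⟨x, y, _, c, rfl, rfl, rfl, rfl⟩
      exact scaleBot_add x y
    · intro h
      obtain ⟨c, hr, hs, ht⟩ := exists_stalkTmul_eq₃ r s t
      refine ⟨_, _, _, c, ?_, hr, hs, ht⟩
      change floorBot c (stalkValue q t) = _
      rw [h]
      exact floorBot_add (congrArg (stalkValue q) hr) (congrArg (stalkValue q) hs)
  add_iff r s t := by
    constructor
    · rintro ⟨x, y, z, c, h, rfl, rfl, rfl⟩
      have hmax := MaxTwice.iff_ne_and_eq_max_or_eq_and_le (α := WithBot ℤ).mpr h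
      exact MaxTwice.map (f := scaleBot c) (monotone_scaleBot c.2.1) hmax
    · intro h
      obtain ⟨c, hr, hs, ht⟩ := exists_stalkTmul_eq₃ r s t
      exact ⟨_, _, _, c, MaxTwice.iff_ne_and_eq_max_or_eq_and_le.mp
        (h.map (monotone_floorBot c.2.1)), hr, hs, ht⟩

end Tensor

/-! ### Sheaves of hyperrings given by germs -/

namespace HyperSheaf

variable {X : TopCat.{0}} {F G : HyperSheaf X}

/-- Two families of germs satisfying `p` which agree at a point agree near that point. -/
def LocallyUnique {T : X → Type} (p : ∀ {U : Opens X}, (∀ x : U, T x) → Prop) : Prop :=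
  ∀ (U : Opens X) (f g : ∀ x : U, T x), p f → p g → ∀ x : U, f x = g x →
    ∃ V : Opens X, x.1 ∈ V ∧ ∀ y : U, y.1 ∈ V → f y = g y

theorem LocallyUnique.sheafify {T : X → Type} {P : TopCat.PrelocalPredicate T}
    (h : LocallyUnique P.pred) : LocallyUnique P.sheafify.pred := by
  intro U f g hf hg x hx
  obtain ⟨V, hV, i, hf⟩ := hf x
  obtain ⟨W, hW, j, hg⟩ := hg x
  obtain ⟨V', hV', hfg⟩ := h (V ⊓ W) _ _ (P.res (Opens.infLELeft V W) _ hf)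
    (P.res (Opens.infLERight V W) _ hg) ⟨x.1, hV, hW⟩ hx
  exact ⟨V ⊓ W ⊓ V', ⟨⟨hV, hW⟩, hV'⟩, fun y hy => hfg ⟨y.1, hy.1⟩ hy.2⟩

/-- The restriction of a section. -/
def resSec {U V : Opens X} (hVU : V ≤ U) (s : F.Sections U) : F.Sections V :=
  F.toSheaf.presheaf.map (homOfLE hVU).op s

theorem sections_ext {U : Opens X} {s t : F.Sections U} (h : ∀ x, F.germ s x = F.germ t x) :
    s = t :=
  Subtype.ext (funext h)

theorem exists_resSec_eq (hF : LocallyUnique F.sec.pred) {U V : Opens X} (s : F.Sections U)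
    (t : F.Sections V) {x : X} (hU : x ∈ U) (hV : x ∈ V)
    (h : F.germ s ⟨x, hU⟩ = F.germ t ⟨x, hV⟩) :
    ∃ (W : Opens X) (hWU : W ≤ U) (hWV : W ≤ V), x ∈ W ∧ resSec hWU s = resSec hWV t := by
  obtain ⟨W, hW, hst⟩ := hF (U ⊓ V) _ _ (resSec inf_le_left s).2 (resSec inf_le_right t).2
    ⟨x, hU, hV⟩ h
  exact ⟨U ⊓ V ⊓ W, inf_le_left.trans inf_le_left, inf_le_left.trans inf_le_right,
    ⟨⟨hU, hV⟩, hW⟩, sections_ext fun y => hst ⟨y.1, y.2.1⟩ y.2.2⟩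

/-- The relation `r` between germs is a subsheaf of `F × F × F`. -/
def IsOpenRel (F : HyperSheaf X) (r : ∀ x, F.stalk x → F.stalk x → F.stalk x → Prop) : Prop :=
  ∀ (U : Opens X) (s t u : F.Sections U) (x : U), r x.1 (F.germ s x) (F.germ t x) (F.germ u x) →
    ∃ V : Opens X, x.1 ∈ V ∧
      ∀ y : U, y.1 ∈ V → r y.1 (F.germ s y) (F.germ t y) (F.germ u y)

theorem isOpenRel_of_exists_sections {r : ∀ x, F.stalk x → F.stalk x → F.stalk x → Prop}
    (hF : LocallyUnique F.sec.pred)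
    (hr : ∀ (x : X) (a b c : F.stalk x), r x a b c →
      ∃ (U : Opens X) (hx : x ∈ U) (s t u : F.Sections U),
        F.germ s ⟨x, hx⟩ = a ∧ F.germ t ⟨x, hx⟩ = b ∧ F.germ u ⟨x, hx⟩ = c ∧
        ∀ y : U, r y.1 (F.germ s y) (F.germ t y) (F.germ u y)) : F.IsOpenRel r := by
  intro U s t u x hx
  obtain ⟨V, hV, s', t', u', hs, ht, hu, H⟩ := hr _ _ _ _ hx
  obtain ⟨W₁, hU₁, hV₁, h₁, e₁⟩ := exists_resSec_eq hF s s' x.2 hV hs.symm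
  obtain ⟨W₂, hU₂, hV₂, h₂, e₂⟩ := exists_resSec_eq hF t t' x.2 hV ht.symm
  obtain ⟨W₃, hU₃, hV₃, h₃, e₃⟩ := exists_resSec_eq hF u u' x.2 hV hu.symm
  refine ⟨W₁ ⊓ W₂ ⊓ W₃, ⟨⟨h₁, h₂⟩, h₃⟩, fun y hy => ?_⟩
  have hs' : F.germ s y = F.germ s' ⟨y.1, hV₁ hy.1.1⟩ := congrArg (F.germ · ⟨y.1, hy.1.1⟩) e₁
  have ht' : F.germ t y = F.germ t' ⟨y.1, hV₂ hy.1.2⟩ := congrArg (F.germ · ⟨y.1, hy.1.2⟩) e₂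
  have hu' : F.germ u y = F.germ u' ⟨y.1, hV₃ hy.2⟩ := congrArg (F.germ · ⟨y.1, hy.2⟩) e₃
  rw [hs', ht', hu']
  exact H ⟨y.1, hV₁ hy.1.1⟩

section InverseImage

variable {Y : TopCat.{0}} (f : Y ⟶ X)

theorem exists_germ_inverseImage_eq {U : Opens Y} (t : (F.inverseImage f).Sections U) (y : U) :
    ∃ (V : Opens X) (_ : f y.1 ∈ V) (s : F.Sections V) (W : Opens Y), y.1 ∈ W ∧
      ∀ z : U, z.1 ∈ W → ∃ h : f z.1 ∈ V, (F.inverseImage f).germ t z = F.germ s ⟨f z.1, h⟩ := by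
  obtain ⟨W, hW, _, V, hV, s, hs⟩ := t.2 y
  exact ⟨V, hV ⟨y.1, hW⟩, s, W, hW, fun z hz => ⟨hV ⟨z.1, hz⟩, hs ⟨z.1, hz⟩⟩⟩

theorem pred_inverseImage {U : Opens Y} {V : Opens X} (s : F.Sections V) (h : ∀ y ∈ U, f y ∈ V) :
    (F.inverseImage f).sec.pred fun y : U => F.germ s ⟨f y.1, h y.1 y.2⟩ :=
  TopCat.PrelocalPredicate.sheafifyOf ⟨V, fun y => h y.1 y.2, s, fun _ => rfl⟩

theorem LocallyUnique.inverseImage (hF : LocallyUnique F.sec.pred) :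
    LocallyUnique (F.inverseImage f).sec.pred := by
  refine LocallyUnique.sheafify ?_
  rintro U t t' ⟨V, hV, s, hs⟩ ⟨V', hV', s', hs'⟩ y hy
  obtain ⟨W, hWV, hWV', hW, e⟩ := exists_resSec_eq hF s s' (hV y) (hV' y)
    ((hs y).symm.trans (hy.trans (hs' y)))
  refine ⟨(Opens.map f).obj W, hW, fun z hz => ?_⟩
  rw [hs, hs']
  exact congrArg (F.germ · ⟨f z.1, hz⟩) e

theorem IsOpenRel.inverseImage {r : ∀ x, F.stalk x → F.stalk x → F.stalk x → Prop}
    (hr : F.IsOpenRel r) : (F.inverseImage f).IsOpenRel fun y => r (f y) := by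
  intro U s t u y hy
  obtain ⟨V₁, hV₁, s', W₁, hW₁, hs⟩ := exists_germ_inverseImage_eq f s y
  obtain ⟨V₂, hV₂, t', W₂, hW₂, ht⟩ := exists_germ_inverseImage_eq f t y
  obtain ⟨V₃, hV₃, u', W₃, hW₃, hu⟩ := exists_germ_inverseImage_eq f u y
  rw [(hs y hW₁).2, (ht y hW₂).2, (hu y hW₃).2] at hy
  obtain ⟨V, hV, H⟩ := hr (V₁ ⊓ V₂ ⊓ V₃) (resSec (inf_le_left.trans inf_le_left) s')
    (resSec (inf_le_left.trans inf_le_right) t') (resSec inf_le_right u')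
    ⟨f y.1, ⟨hV₁, hV₂⟩, hV₃⟩ hy
  refine ⟨W₁ ⊓ W₂ ⊓ W₃ ⊓ (Opens.map f).obj V, ⟨⟨⟨hW₁, hW₂⟩, hW₃⟩, hV⟩, fun z hz => ?_⟩
  obtain ⟨⟨⟨hz₁, hz₂⟩, hz₃⟩, hzV⟩ := hz
  obtain ⟨h₁, hs⟩ := hs z hz₁
  obtain ⟨h₂, ht⟩ := ht z hz₂
  obtain ⟨h₃, hu⟩ := hu z hz₃
  rw [hs, ht, hu]
  exact H ⟨f z.1, ⟨h₁, h₂⟩, h₃⟩ hzV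

theorem IsSheafOfHyperrings.locallyUnique (hF : F.IsSheafOfHyperrings) :
    LocallyUnique F.sec.pred :=
  fun U s t hs ht x h => hF.germ_ext U ⟨s, hs⟩ ⟨t, ht⟩ x h

theorem IsSheafOfHyperrings.inverseImage (hF : F.IsSheafOfHyperrings) :
    (F.inverseImage f).IsSheafOfHyperrings where
  exists_germ y t := by
    obtain ⟨V, hV, s, hs⟩ := hF.exists_germ (f y) t
    exact ⟨(Opens.map f).obj V, hV, ⟨_, pred_inverseImage f s fun _ h => h⟩, hs⟩
  germ_ext U s t y h := hF.locallyUnique.inverseImage f U s.1 t.1 s.2 t.2 y h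
  zero_sec _ := pred_inverseImage f ⟨_, hF.zero_sec ⊤⟩ fun _ _ => trivial
  one_sec _ := pred_inverseImage f ⟨_, hF.one_sec ⊤⟩ fun _ _ => trivial
  mul_open := IsOpenRel.inverseImage f (r := fun x => (F.str x).mul) hF.mul_open
  add_open := IsOpenRel.inverseImage f (r := fun x => (F.str x).add) hF.add_open
  hyperring y := hF.hyperring (f y)

end InverseImage

/-! ### Isomorphisms of sheaves of hyperrings -/

theorem pred_comp (hF : LocallyUnique F.sec.pred) (φ : ∀ x, F.stalk x → G.stalk x)
    (hφ : ∀ (x : X) (t : F.stalk x), ∃ (U : Opens X) (hx : x ∈ U) (s : F.Sections U)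
      (s' : G.Sections U), F.germ s ⟨x, hx⟩ = t ∧ ∀ y, G.germ s' y = φ y.1 (F.germ s y))
    {U : Opens X} {f : ∀ x : U, F.stalk x.1} (hf : F.sec.pred f) :
    G.sec.pred fun x => φ x.1 (f x) := by
  refine G.sec.locality _ fun x => ?_
  obtain ⟨V, hV, s, s', hs, hs'⟩ := hφ x.1 (f x)
  obtain ⟨W, hWU, hWV, hW, h⟩ := exists_resSec_eq hF ⟨f, hf⟩ s x.2 hV hs.symm
  refine ⟨W, hW, homOfLE hWU, ?_⟩
  convert (resSec hWV s').2 using 2 with y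
  have hy : f ⟨y.1, hWU y.2⟩ = F.germ s ⟨y.1, hWV y.2⟩ := congrArg (F.germ · y) h
  exact (congrArg (φ y.1) hy).trans (hs' ⟨y.1, hWV y.2⟩).symm

/-- The isomorphism of sheaves defined by equivalences of the stalks which identify
the sections. -/
def isoOfStalkEquiv (φ : ∀ x, F.stalk x ≃ G.stalk x)
    (h : ∀ {U : Opens X} {f : ∀ x : U, F.stalk x.1}, F.sec.pred f →
      G.sec.pred fun x => φ x.1 (f x))
    (h' : ∀ {U : Opens X} {g : ∀ x : U, G.stalk x.1}, G.sec.pred g →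
      F.sec.pred fun x => (φ x.1).symm (g x)) : F.toSheaf ≅ G.toSheaf where
  hom := ⟨{ app := fun _ => ↾fun s => ⟨fun x => φ x.1 (s.1 x), h s.2⟩ }⟩
  inv := ⟨{ app := fun _ => ↾fun s => ⟨fun x => (φ x.1).symm (s.1 x), h' s.2⟩ }⟩
  hom_inv_id := by
    refine ObjectProperty.hom_ext _ (NatTrans.ext (funext fun U => ?_))
    ext s
    exact Subtype.ext (funext fun x => (φ x.1).symm_apply_apply _)
  inv_hom_id := by
    refine ObjectProperty.hom_ext _ (NatTrans.ext (funext fun U => ?_))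
    ext s
    exact Subtype.ext (funext fun x => (φ x.1).apply_symm_apply _)

theorem iso_ext {Φ Ψ : F.toSheaf ≅ G.toSheaf}
    (h : ∀ (U : Opens X) (s : F.Sections U) (x : U),
      G.germ (mapSec Φ s) x = G.germ (mapSec Ψ s) x) : Φ = Ψ := by
  refine Iso.ext (ObjectProperty.hom_ext _ (NatTrans.ext (funext fun U => ?_)))
  ext s
  exact sections_ext (h U.unop s)

theorem mapSec_resSec (Φ : F.toSheaf ≅ G.toSheaf) {U V : Opens X} (hVU : V ≤ U)
    (s : F.Sections U) : mapSec Φ (resSec hVU s) = resSec hVU (mapSec Φ s) :=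
  NatTrans.naturality_apply Φ.hom.hom (homOfLE hVU).op s

theorem germ_mapSec_eq_zero (hF : F.IsSheafOfHyperrings) {Φ : F.toSheaf ≅ G.toSheaf}
    (hΦ : IsHyperringIso Φ) {U : Opens X} {s : F.Sections U} {x : U}
    (hx : F.germ s x = (F.str x.1).zero) : G.germ (mapSec Φ s) x = (G.str x.1).zero := by
  obtain ⟨V, hV, h⟩ := hF.germ_ext U s ⟨_, hF.zero_sec U⟩ x hx
  have hzero := (hΦ.zero_iff (resSec (inf_le_left : U ⊓ V ≤ U) s)).mp
    fun y => h ⟨y.1, y.2.1⟩ y.2.2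
  rw [mapSec_resSec] at hzero
  exact hzero ⟨x.1, x.2, hV⟩

theorem germ_mapSec_eq_one (hF : F.IsSheafOfHyperrings) {Φ : F.toSheaf ≅ G.toSheaf}
    (hΦ : IsHyperringIso Φ) {U : Opens X} {s : F.Sections U} {x : U}
    (hx : F.germ s x = (F.str x.1).one) : G.germ (mapSec Φ s) x = (G.str x.1).one := by
  obtain ⟨V, hV, h⟩ := hF.germ_ext U s ⟨_, hF.one_sec U⟩ x hx
  have hone := (hΦ.one_iff (resSec (inf_le_left : U ⊓ V ≤ U) s)).mp
    fun y => h ⟨y.1, y.2.1⟩ y.2.2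
  rw [mapSec_resSec] at hone
  exact hone ⟨x.1, x.2, hV⟩

section Tropical

variable {Γ : Type} [AddCommGroup Γ] [LinearOrder Γ] {S : X → AddSubgroup Γ}
  {val : ∀ x, F.stalk x → WithBot Γ} {val' : ∀ x, G.stalk x → WithBot Γ}

theorem isHyperringIso_of_isTropical (H : ∀ x, (F.str x).IsTropical (S x) (val x))
    (H' : ∀ x, (G.str x).IsTropical (S x) (val' x)) {Φ : F.toSheaf ≅ G.toSheaf}
    (hΦ : ∀ {U : Opens X} (s : F.Sections U) (x : U),
      val' x.1 (G.germ (mapSec Φ s) x) = val x.1 (F.germ s x)) : IsHyperringIso Φ where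
  zero_iff s := forall_congr' fun x => by
    rw [← (H x.1).injective.eq_iff, ← (H' x.1).injective.eq_iff, hΦ, (H x.1).val_zero,
      (H' x.1).val_zero]
  one_iff s := forall_congr' fun x => by
    rw [← (H x.1).injective.eq_iff, ← (H' x.1).injective.eq_iff, hΦ, (H x.1).val_one,
      (H' x.1).val_one]
  mul_iff r s t := forall_congr' fun x => by
    rw [(H x.1).mul_iff, (H' x.1).mul_iff, hΦ, hΦ, hΦ]
  add_iff r s t := forall_congr' fun x => by
    rw [(H x.1).add_iff, (H' x.1).add_iff, hΦ, hΦ, hΦ]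

theorem exists_isHyperringIso_of_isTropical (hF : F.IsSheafOfHyperrings)
    (hG : G.IsSheafOfHyperrings) (H : ∀ x, (F.str x).IsTropical (S x) (val x))
    (H' : ∀ x, (G.str x).IsTropical (S x) (val' x))
    (hext : ∀ (x : X) (t : F.stalk x), ∃ (U : Opens X) (hx : x ∈ U) (s : F.Sections U)
      (s' : G.Sections U), F.germ s ⟨x, hx⟩ = t ∧
        ∀ y, val' y.1 (G.germ s' y) = val y.1 (F.germ s y)) :
    ∃ Φ : F.toSheaf ≅ G.toSheaf, IsHyperringIso Φ ∧
      ∀ {U : Opens X} (s : F.Sections U) (x : U),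
        val' x.1 (G.germ (mapSec Φ s) x) = val x.1 (F.germ s x) := by
  let φ x := (H x).equiv (H' x)
  have hφ {x : X} {a : F.stalk x} {b : G.stalk x} (h : val' x b = val x a) : b = φ x a :=
    (H' x).injective (h.trans ((H x).val_equiv (H' x) a).symm)
  refine ⟨isoOfStalkEquiv φ (pred_comp hF.locallyUnique (fun x => φ x) fun x t => ?_)
    (pred_comp hG.locallyUnique (fun x => (φ x).symm) fun x t => ?_), ?_⟩
  · obtain ⟨U, hx, s, s', hs, h⟩ := hext x t
    exact ⟨U, hx, s, s', hs, fun y => hφ (h y)⟩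
  · obtain ⟨U, hx, s, s', hs, h⟩ := hext x ((φ x).symm t)
    refine ⟨U, hx, s', s, ?_, fun y => ((φ y.1).symm_apply_eq.mpr (hφ (h y))).symm⟩
    rw [hφ (h ⟨x, hx⟩), hs, Equiv.apply_symm_apply]
  · have hval {U : Opens X} (s : F.Sections U) (x : U) :=
      (H x.1).val_equiv (H' x.1) (F.germ s x)
    exact ⟨isHyperringIso_of_isTropical H H' hval, hval⟩

end Tropical

end HyperSheaf

/-! ### Germs of Cartier divisor classes -/

section Cartier

variable {R K : Type} [CommRing R] [Field K] [Algebra R K]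

theorem pred_cartierSheaf_mk (U : Opens (TopCat.of (PrimeSpectrum R))) (f : K) :
    (cartierSheaf R K).sec.pred fun x : U => UnitQuotient.mk (localUnits R K x.1) f :=
  TopCat.PrelocalPredicate.sheafifyOf ⟨f, fun _ => rfl⟩

/-- The principal divisor class of `f`, as a global section. -/
def principalSec (f : K) : (cartierSheaf R K).Sections ⊤ :=
  ⟨_, pred_cartierSheaf_mk ⊤ f⟩

theorem exists_germ_principalSec {x : PrimeSpectrum R} (t : (cartierSheaf R K).stalk x) :
    ∃ f, (cartierSheaf R K).germ (principalSec f) ⟨x, trivial⟩ = t := by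
  induction t using Quotient.ind with
  | _ f => exact ⟨f, rfl⟩

theorem locallyUnique_cartierSheaf : LocallyUnique (cartierSheaf R K).sec.pred := by
  refine LocallyUnique.sheafify ?_
  rintro U s t ⟨f, hf⟩ ⟨g, hg⟩ x hx
  rw [hf, hg] at hx
  obtain ⟨u, hu, rfl⟩ := UnitQuotient.mk_eq_mk_iff.mp hx
  obtain ⟨V, hV, huV⟩ := exists_opens_forall_mem_localUnits hu
  refine ⟨V, hV, fun y hy => ?_⟩
  rw [hf, hg]
  exact UnitQuotient.mk_eq_mk_iff.mpr ⟨u, huV y.1 hy, rfl⟩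

theorem isSheafOfHyperrings_cartierSheaf
    (h : ∀ x, (UnitQuotient.str K (localUnits R K x)).IsHyperring) :
    (cartierSheaf R K).IsSheafOfHyperrings where
  exists_germ _ t := ⟨⊤, trivial, (exists_germ_principalSec t).imp' principalSec fun _ => id⟩
  germ_ext U s t := locallyUnique_cartierSheaf U s.1 t.1 s.2 t.2
  zero_sec U := pred_cartierSheaf_mk U 0
  one_sec U := pred_cartierSheaf_mk U 1
  mul_open := isOpenRel_of_exists_sections (F := cartierSheaf R K)
      (r := fun x => ((cartierSheaf R K).str x).mul) locallyUnique_cartierSheaf <| by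
    rintro x _ _ _ ⟨a, b, rfl, rfl, rfl⟩
    exact ⟨⊤, trivial, principalSec a, principalSec b, principalSec (a * b), rfl, rfl, rfl,
      fun _ => ⟨a, b, rfl, rfl, rfl⟩⟩
  add_open := isOpenRel_of_exists_sections (F := cartierSheaf R K)
      (r := fun x => ((cartierSheaf R K).str x).add) locallyUnique_cartierSheaf <| by
    rintro x _ _ _ ⟨a, b, rfl, rfl, rfl⟩
    exact ⟨⊤, trivial, principalSec a, principalSec b, principalSec (a + b), rfl, rfl, rfl,
      fun _ => ⟨a, b, rfl, rfl, rfl⟩⟩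
  hyperring := h

end Cartier

/-! ### Germs of the inverse image of the structure sheaf -/

section Theta

variable {q : PrimeSpectrum ℤ} {c : thetaStalk q}

theorem isClosed_singleton_of_thetaStalk (hc : (c : ℚ) ≠ 0) :
    IsClosed ({q} : Set (PrimeSpectrum ℤ)) := by
  rw [PrimeSpectrum.isClosed_singleton_iff_isMaximal]
  obtain ⟨p, hp, hq, -⟩ := c.2.2.resolve_left hc
  refine IsPrime.to_maximal_ideal fun h => hp.ne_zero ?_
  rwa [h, Ideal.mem_bot, Nat.cast_eq_zero] at hq

theorem IsThetaSection.exists_opens_forall_eq_thetaZero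
    {U : Opens (TopCat.of (PrimeSpectrum ℤ))} {c : ∀ q : U, thetaStalk q.1}
    (hc : IsThetaSection c) (q : U) :
    ∃ V : Opens (TopCat.of (PrimeSpectrum ℤ)), q.1 ∈ V ∧
      ∀ y : U, y.1 ∈ V → y ≠ q → c y = thetaZero y.1 := by
  have hfin : {y : U | (c y : ℚ) ≠ 0 ∧ y ≠ q}.Finite := Set.Finite.subset hc fun _ => And.left
  have hclosed : IsClosed (⋃ y ∈ {y : U | (c y : ℚ) ≠ 0 ∧ y ≠ q}, ({y.1} : Set _)) :=
    hfin.isClosed_biUnion fun y hy => isClosed_singleton_of_thetaStalk hy.1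
  refine ⟨⟨_, hclosed.isOpen_compl⟩, fun hq => ?_, fun y hy hne => ?_⟩
  · obtain ⟨y, hy, hqy⟩ := Set.mem_iUnion₂.mp hq
    exact hy.2 (Subtype.ext hqy.symm)
  · by_contra h
    exact hy (Set.mem_iUnion₂.mpr ⟨y, ⟨fun h0 => h (Subtype.ext h0), hne⟩, rfl⟩)

theorem scaleBot_eq_bot_iff {c : ℚ} {x : WithBot ℤ} : scaleBot c x = ⊥ ↔ x = ⊥ :=
  WithBot.map_eq_bot_iff

theorem stalkTmul_thetaZero_congr {x y : WithBot ℤ} (h : x = ⊥ ↔ y = ⊥) (q : PrimeSpectrum ℤ) :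
    stalkTmul x (thetaZero q) = stalkTmul y (thetaZero q) := by
  cases x with
  | bot => rw [h.mp rfl]
  | coe m =>
    cases y with
    | bot => exact absurd (h.mpr rfl) WithBot.coe_ne_bot
    | coe n => rw [stalkTmul_thetaZero m, stalkTmul_thetaZero n]

theorem locallyUnique_thetaInverseImage :
    LocallyUnique (thetaInverseImage ZMax zHmax).sec.pred := by
  refine LocallyUnique.sheafify ?_
  rintro U s t ⟨x, c, hc, hs⟩ ⟨y, d, hd, ht⟩ q hq
  obtain ⟨V, hV, hcV⟩ := hc.exists_opens_forall_eq_thetaZero q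
  obtain ⟨W, hW, hdW⟩ := hd.exists_opens_forall_eq_thetaZero q
  refine ⟨V ⊓ W, ⟨hV, hW⟩, fun r hr => ?_⟩
  by_cases h : r = q
  · rw [h, hq]
  rw [hs, ht] at hq
  have hval : scaleBot (c q) x = ⊥ ↔ scaleBot (d q) y = ⊥ := by
    rw [show scaleBot (c q) x = scaleBot (d q) y from congrArg (stalkValue q.1) hq]
  rw [hs, ht, hcV r hr.1 h, hdW r hr.2 h]
  exact stalkTmul_thetaZero_congr
    (scaleBot_eq_bot_iff.symm.trans (hval.trans scaleBot_eq_bot_iff)) r.1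

open Classical in
/-- The family of elements of the stalks of `𝒮` with value `c` at `q` and zero elsewhere. -/
noncomputable def thetaSingle (c : thetaStalk q) (r : PrimeSpectrum ℤ) : thetaStalk r :=
  if h : r = q then h ▸ c else thetaZero r

theorem thetaSingle_same (c : thetaStalk q) : thetaSingle c q = c :=
  dif_pos rfl

theorem thetaSingle_of_ne {r : PrimeSpectrum ℤ} (c : thetaStalk q) (h : r ≠ q) :
    thetaSingle c r = thetaZero r :=
  dif_neg h

theorem pred_thetaInverseImage_stalkTmul (U : Opens (TopCat.of (PrimeSpectrum ℤ)))
    (x : WithBot ℤ) {c : ∀ r : U, thetaStalk r.1} (hc : IsThetaSection c) :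
    (thetaInverseImage ZMax zHmax).sec.pred fun r : U => stalkTmul x (c r) :=
  TopCat.PrelocalPredicate.sheafifyOf ⟨x, c, hc, fun _ => rfl⟩

theorem isThetaSection_thetaZero (U : Opens (TopCat.of (PrimeSpectrum ℤ))) :
    IsThetaSection fun r : U => thetaZero r.1 :=
  Set.finite_empty.subset fun _ h => h rfl

theorem isThetaSection_thetaSingle (U : Opens (TopCat.of (PrimeSpectrum ℤ))) (c : thetaStalk q) :
    IsThetaSection fun r : U => thetaSingle c r.1 := by
  refine Set.Subsingleton.finite fun r hr r' hr' => Subtype.ext ?_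
  have key {r : U} (hr : (thetaSingle c r.1 : ℚ) ≠ 0) : r.1 = q := by
    by_contra h
    exact hr (congrArg Subtype.val (thetaSingle_of_ne c h))
  rw [key hr, key hr']

/-- The global section of `Θ^* ℤ_max` with germ `x ⊗ c` at `q` and `x ⊗ 0` elsewhere. -/
noncomputable def tmulSec (x : WithBot ℤ) (c : thetaStalk q) :
    (thetaInverseImage ZMax zHmax).Sections ⊤ :=
  ⟨_, pred_thetaInverseImage_stalkTmul ⊤ x (isThetaSection_thetaSingle ⊤ c)⟩

theorem germ_tmulSec (x : WithBot ℤ) (c : thetaStalk q) :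
    (thetaInverseImage ZMax zHmax).germ (tmulSec x c) ⟨q, trivial⟩ = stalkTmul x c :=
  congrArg (stalkTmul x) (thetaSingle_same c)

theorem isSheafOfHyperrings_thetaInverseImage :
    (thetaInverseImage ZMax zHmax).IsSheafOfHyperrings where
  exists_germ q t := by
    obtain ⟨⟨x, c⟩, rfl⟩ := Quot.exists_rep t
    exact ⟨⊤, trivial, tmulSec x c, germ_tmulSec x c⟩
  germ_ext U s t := locallyUnique_thetaInverseImage U s.1 t.1 s.2 t.2
  zero_sec U := pred_thetaInverseImage_stalkTmul U ⊥ (isThetaSection_thetaZero U)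
  one_sec U := pred_thetaInverseImage_stalkTmul U 0 (isThetaSection_thetaZero U)
  mul_open := isOpenRel_of_exists_sections (F := thetaInverseImage ZMax zHmax)
      (r := fun q => ((thetaInverseImage ZMax zHmax).str q).mul)
      locallyUnique_thetaInverseImage <| by
    rintro q _ _ _ ⟨x, y, z, c, h, rfl, rfl, rfl⟩
    exact ⟨⊤, trivial, tmulSec x c, tmulSec y c, tmulSec z c, germ_tmulSec x c, germ_tmulSec y c,
      germ_tmulSec z c, fun r => ⟨x, y, z, thetaSingle c r.1, h, rfl, rfl, rfl⟩⟩
  add_open := isOpenRel_of_exists_sections (F := thetaInverseImage ZMax zHmax)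
      (r := fun q => ((thetaInverseImage ZMax zHmax).str q).add)
      locallyUnique_thetaInverseImage <| by
    rintro q _ _ _ ⟨x, y, z, c, h, rfl, rfl, rfl⟩
    exact ⟨⊤, trivial, tmulSec x c, tmulSec y c, tmulSec z c, germ_tmulSec x c, germ_tmulSec y c,
      germ_tmulSec z c, fun r => ⟨x, y, z, thetaSingle c r.1, h, rfl, rfl, rfl⟩⟩
  hyperring q := (isTropical_stalkValue q).isHyperring

theorem isSheafOfHyperrings_pullbackStructureSheaf :
    pullbackStructureSheaf.IsSheafOfHyperrings :=
  isSheafOfHyperrings_thetaInverseImage.inverseImage specMap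

end Theta

/-! ### The stalks of the sheaf of Cartier divisor classes -/

theorem negValue_le_negValue {a b : WithTop ℚ} : negValue a ≤ negValue b ↔ b ≤ a := by
  cases a with
  | top => exact iff_of_true bot_le le_top
  | coe r =>
    cases b with
    | top =>
      exact iff_of_false (WithBot.bot_lt_coe _).not_ge (WithTop.coe_lt_top _).not_ge
    | coe s => exact WithBot.coe_le_coe.trans (neg_le_neg_iff.trans WithTop.coe_le_coe.symm)

theorem negValue_injective : Function.Injective negValue := fun _ _ h =>
  le_antisymm (negValue_le_negValue.mp h.ge) (negValue_le_negValue.mp h.le)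

theorem negValue_zero : negValue 0 = 0 :=
  congrArg WithBot.some neg_zero

theorem negValue_eq_coe_iff {a : WithTop ℚ} {r : ℚ} : negValue a = r ↔ a = (-r : ℚ) := by
  rw [← negValue_injective.eq_iff]
  change _ ↔ negValue a = ((- -r : ℚ) : WithBot ℚ)
  rw [neg_neg]

theorem negValue_add (a b : WithTop ℚ) : negValue (a + b) = negValue a + negValue b := by
  cases a with
  | top => rfl
  | coe r =>
    cases b with
    | top => rfl
    | coe s => exact congrArg WithBot.some (neg_add r s)

theorem maxTwice_negValue_iff {a b c : WithTop ℚ} :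
    MaxTwice (negValue a) (negValue b) (negValue c) ↔
      min b c ≤ a ∧ min a c ≤ b ∧ min a b ≤ c := by
  simp only [MaxTwice, le_max_iff, min_le_iff, negValue_le_negValue]

section CartierStalk

variable {R K : Type} [CommRing R] [Field K] [Algebra R K] {x : PrimeSpectrum R}
  {w : AddValuation K (WithTop ℚ)}

namespace HasLocalRing

/-- The map `f ↦ -w f` on the quotient of `K` by the units of the valuation ring of `w`. -/
def negValuation (hw : HasLocalRing w x) : UnitQuotient K (localUnits R K x) → WithBot ℚ :=
  Quotient.lift (fun f => negValue (w f)) fun _ _ h =>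
    congrArg negValue (hw.mk_eq_mk_iff.mp (Quotient.sound h))

theorem negValuation_injective (hw : HasLocalRing w x) : Function.Injective hw.negValuation := by
  rintro ⟨f⟩ ⟨g⟩ h
  exact hw.mk_eq_mk_iff.mpr (negValue_injective h)

theorem exists_add_of_maxTwice (hw : HasLocalRing w x)
    (hu : ∃ u ∈ localUnits R K x, ∃ u' ∈ localUnits R K x, (u + u' : K) = 1) {f g h : K}
    (H : MaxTwice (negValue (w f)) (negValue (w g)) (negValue (w h))) :
    ∃ a b : K, w a = w f ∧ w b = w g ∧ w (a + b) = w h := by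
  obtain ⟨h₁, h₂, h₃⟩ := maxTwice_negValue_iff.mp H
  rcases lt_trichotomy (w f) (w g) with hlt | heq | hlt
  · refine ⟨f, g, rfl, rfl, ?_⟩
    rw [w.map_add_eq_of_lt_left hlt]
    rw [min_eq_left hlt.le] at h₃
    exact h₃.antisymm ((min_le_iff.mp h₁).resolve_left hlt.not_ge)
  · rw [← heq, min_self] at h₃
    rcases h₃.lt_or_eq with h₃ | h₃
    · exact ⟨f, h - f, rfl, by rw [w.map_sub_eq_of_lt_right h₃, heq], by rw [add_sub_cancel]⟩
    · obtain ⟨u, hu, u', hu', huu'⟩ := hu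
      refine ⟨u * h, u' * h, ?_, ?_, by rw [← add_mul, huu', one_mul]⟩
      · rw [w.map_mul, hw.mem_localUnits_iff.mp hu, zero_add, h₃]
      · rw [w.map_mul, hw.mem_localUnits_iff.mp hu', zero_add, ← heq, h₃]
  · refine ⟨f, g, rfl, rfl, ?_⟩
    rw [w.map_add_eq_of_lt_right hlt]
    rw [min_eq_right hlt.le] at h₃
    exact h₃.antisymm ((min_le_iff.mp h₂).resolve_left hlt.not_ge)

theorem isTropical_negValuation (hw : HasLocalRing w x)
    (hu : ∃ u ∈ localUnits R K x, ∃ u' ∈ localUnits R K x, (u + u' : K) = 1)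
    {S : AddSubgroup ℚ} (hS : ∀ r : ℚ, (∃ f, w f = r) ↔ r ∈ S) :
    (UnitQuotient.str K (localUnits R K x)).IsTropical S hw.negValuation where
  injective := hw.negValuation_injective
  exists_val_eq_coe_iff r := by
    rw [← neg_mem_iff, ← hS]
    constructor
    · rintro ⟨⟨f⟩, hf⟩
      exact ⟨f, negValue_eq_coe_iff.mp hf⟩
    · rintro ⟨f, hf⟩
      exact ⟨UnitQuotient.mk _ f, negValue_eq_coe_iff.mpr hf⟩
  val_zero := congrArg negValue w.map_zero
  val_one := (congrArg negValue w.map_one).trans negValue_zero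
  mul_iff := by
    have hmul (f g : K) : negValue (w (f * g)) = negValue (w f) + negValue (w g) := by
      rw [w.map_mul, negValue_add]
    rintro ⟨f⟩ ⟨g⟩ t
    constructor
    · rintro ⟨a, b, ha, hb, rfl⟩
      rw [← ha, ← hb]
      exact hmul a b
    · intro h
      exact ⟨f, g, rfl, rfl, hw.negValuation_injective ((hmul f g).trans h.symm)⟩
  add_iff := by
    rintro ⟨f⟩ ⟨g⟩ ⟨h⟩
    constructor
    · rintro ⟨a, b, ha, hb, hab⟩
      rw [← ha, ← hb, ← hab]
      refine maxTwice_negValue_iff.mpr ⟨?_, ?_, w.map_add a b⟩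
      · simpa only [add_sub_cancel_right, min_comm] using w.map_sub (a + b) b
      · simpa only [add_sub_cancel_left, min_comm] using w.map_sub (a + b) a
    · intro H
      obtain ⟨a, b, ha, hb, hab⟩ := hw.exists_add_of_maxTwice hu H
      exact ⟨a, b, hw.mk_eq_mk_iff.mpr ha, hw.mk_eq_mk_iff.mpr hb, hw.mk_eq_mk_iff.mpr hab⟩

end HasLocalRing

end CartierStalk

/-! ### Valuations at all points of `Spec 𝒪^cyc` -/

section Points

theorem natCast_mem_specMap_iff {P : PrimeSpectrum Ocyc} {p : ℕ} :
    (p : ℤ) ∈ (specMap P).asIdeal ↔ (p : Ocyc) ∈ P.asIdeal := by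
  change algebraMap ℤ Ocyc (p : ℤ) ∈ P.asIdeal ↔ _
  rw [map_natCast]

theorem asIdeal_eq_bot_or_exists_prime_mem (P : PrimeSpectrum Ocyc) :
    P.asIdeal = ⊥ ∨ ∃ p : ℕ, p.Prime ∧ (p : Ocyc) ∈ P.asIdeal := by
  refine or_iff_not_imp_left.mpr fun h => ?_
  obtain ⟨a, ha, ha0⟩ := Submodule.exists_mem_ne_zero_of_ne_bot h
  have hbot : (specMap P).asIdeal ≠ ⊥ :=
    Ideal.comap_ne_bot_of_integral_mem ha0 ha (NumberField.RingOfIntegers.isIntegral a)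
  have hprime := Submodule.IsPrincipal.prime_generator_of_isPrime _ hbot
  refine ⟨_, Int.prime_iff_natAbs_prime.mp hprime, natCast_mem_specMap_iff.mp ?_⟩
  rw [Int.natCast_natAbs, abs_mem_iff]
  exact Submodule.IsPrincipal.generator_mem _

theorem eq_of_natCast_mem_asIdeal {q r : PrimeSpectrum ℤ} {p : ℕ} (hp : p.Prime)
    (hq : (p : ℤ) ∈ q.asIdeal) (hr : (p : ℤ) ∈ r.asIdeal) : q = r := by
  have hmax : (Ideal.span {(p : ℤ)}).IsMaximal :=
    PrincipalIdealRing.isMaximal_of_irreducible (Nat.prime_iff_prime_int.mp hp).irreducible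
  have key (s : PrimeSpectrum ℤ) (hs : (p : ℤ) ∈ s.asIdeal) : Ideal.span {(p : ℤ)} = s.asIdeal :=
    hmax.eq_of_le s.isPrime.ne_top ((Ideal.span_singleton_le_iff_mem _).mpr hs)
  exact PrimeSpectrum.ext ((key q hq).symm.trans (key r hr))

theorem exists_units_add_eq_one : ∃ u u' : Ocycˣ, (u : Ocyc) + u' = 1 := by
  have hζ := (isPrimitiveRoot_zetaCyc 3).toInteger_isPrimitiveRoot
  have hsum := hζ.geom_sum_eq_zero (by norm_num)
  simp only [Finset.sum_range_succ, Finset.sum_range_zero] at hsum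
  obtain ⟨u, hu⟩ := hζ.isUnit three_ne_zero
  refine ⟨-u, -u ^ 2, ?_⟩
  push_cast
  rw [hu]
  linear_combination -hsum

theorem exists_mem_localUnits_add_eq_one (P : PrimeSpectrum Ocyc) :
    ∃ u ∈ localUnits Ocyc Qcyc P, ∃ u' ∈ localUnits Ocyc Qcyc P, (u : Qcyc) + u' = 1 := by
  obtain ⟨u, u', h⟩ := exists_units_add_eq_one
  exact ⟨_, map_algebraMap_mem_localUnits u, _, map_algebraMap_mem_localUnits u',
    (map_add (algebraMap Ocyc Qcyc) u.1 u'.1).symm.trans (by rw [h, map_one])⟩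

/-- A valuation at a point of `Spec 𝒪^cyc`: the valuation `v_℘` at a closed point `℘`, and the
trivial valuation at the generic point. -/
structure IsPointValuation (P : PrimeSpectrum Ocyc) (w : AddValuation Qcyc (WithTop ℚ)) :
    Prop where
  hasLocalRing : HasLocalRing w P
  isNormalized : ∀ p : ℕ, p.Prime → (p : Ocyc) ∈ P.asIdeal → IsNormalizedValuation p P w

theorem exists_isPointValuation (P : PrimeSpectrum Ocyc) : ∃ w, IsPointValuation P w := by
  classical
  rcases asIdeal_eq_bot_or_exists_prime_mem P with hP | ⟨p, hp, hpP⟩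
  · refine ⟨AddValuation.ofValuation (1 : Valuation Qcyc (Multiplicative (WithTop ℚ)ᵒᵈ)),
      fun f => iff_of_true ?_ (mem_localRing_of_asIdeal_eq_bot hP f),
      fun p hp hpP => absurd hP (asIdeal_ne_bot_of_natCast_mem hp.ne_zero hpP)⟩
    exact Valuation.one_apply_le_one (Γ₀ := Multiplicative (WithTop ℚ)ᵒᵈ) f
  · obtain ⟨w, hw, -⟩ := existsUnique_isNormalizedValuation hp hpP
    refine ⟨w, hw.nonneg_iff, fun p' hp' hp'P => ?_⟩
    rwa [← prime_eq_of_mem_asIdeal hp hp' (natCast_mem_specMap_iff.mpr hpP)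
      (natCast_mem_specMap_iff.mpr hp'P)]

namespace IsPointValuation

variable {P : PrimeSpectrum Ocyc} {w : AddValuation Qcyc (WithTop ℚ)}

theorem map_eq_zero_of_asIdeal_eq_bot (hw : IsPointValuation P w) (hP : P.asIdeal = ⊥) {f : Qcyc}
    (hf : f ≠ 0) : w f = 0 :=
  (hw.hasLocalRing.mem_localUnits_iff (u := .mk0 f hf)).mp
    ⟨mem_localRing_of_asIdeal_eq_bot hP _, mem_localRing_of_asIdeal_eq_bot hP _⟩

theorem exists_map_eq_coe_iff (hw : IsPointValuation P w) (r : ℚ) :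
    (∃ f, w f = r) ↔ r ∈ valueGroup (specMap P) := by
  rcases asIdeal_eq_bot_or_exists_prime_mem P with hP | ⟨p, hp, hpP⟩
  · rw [mem_valueGroup_iff_of_forall_notMem fun p hp hpP =>
      asIdeal_ne_bot_of_natCast_mem hp.ne_zero (natCast_mem_specMap_iff.mp hpP) hP]
    constructor
    · rintro ⟨f, hf⟩
      have hf0 : f ≠ 0 := w.ne_top_iff.mp (hf ▸ WithTop.coe_ne_top)
      exact WithTop.coe_inj.mp (hf.symm.trans (hw.map_eq_zero_of_asIdeal_eq_bot hP hf0))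
    · rintro rfl
      exact ⟨1, w.map_one⟩
  · rw [mem_valueGroup_iff hp (natCast_mem_specMap_iff.mpr hpP), ← SetLike.mem_coe,
      ← (hw.isNormalized p hp hpP).setOf_map_eq_coe hp hpP, Set.mem_ofPred_eq]

theorem isTropical_negValuation (hw : IsPointValuation P w) :
    ((cartierSheaf Ocyc Qcyc).str P).IsTropical (valueGroup (specMap P))
      hw.hasLocalRing.negValuation :=
  hw.hasLocalRing.isTropical_negValuation (exists_mem_localUnits_add_eq_one P)
    hw.exists_map_eq_coe_iff

end IsPointValuation

theorem exists_forall_isPointValuation_map_eq {P : PrimeSpectrum Ocyc} {r : ℚ}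
    (hr : r ∈ valueGroup (specMap P)) :
    ∃ g : Qcyc, ∀ Q w, IsPointValuation Q w →
      (specMap Q = specMap P → w g = r) ∧ (specMap Q ≠ specMap P → w g = 0) := by
  rcases hr with rfl | ⟨p, hp, hpP, hr⟩
  · exact ⟨1, fun Q w _ => ⟨fun _ => w.map_one, fun _ => w.map_one⟩⟩
  obtain ⟨g, hg, hg'⟩ := exists_forall_isNormalizedValuation_map_eq hp hr
  refine ⟨g, fun Q w hw => ⟨fun hQ => ?_, fun hQ => ?_⟩⟩
  · exact hg Q w (hw.isNormalized p hp (natCast_mem_specMap_iff.mp (hQ ▸ hpP)))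
  · refine hw.hasLocalRing.mem_localUnits_iff.mp (hg' Q fun hpQ => hQ ?_)
    exact eq_of_natCast_mem_asIdeal hp (natCast_mem_specMap_iff.mpr hpQ) hpP

end Points

theorem isSheafOfHyperrings_cartierSheaf_cyc : (cartierSheaf Ocyc Qcyc).IsSheafOfHyperrings :=
  isSheafOfHyperrings_cartierSheaf fun P =>
    (exists_isPointValuation P).choose_spec.isTropical_negValuation.isHyperring

/-! ### The isomorphism -/

/-- The pullback to `Spec 𝒪^cyc` of the global section `tmulSec x c` of `Θ^* ℤ_max`. -/
noncomputable def pullbackTmulSec {q : PrimeSpectrum ℤ} (x : WithBot ℤ) (c : thetaStalk q) :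
    pullbackStructureSheaf.Sections ⊤ :=
  ⟨_, pred_inverseImage specMap (tmulSec x c) fun _ _ => trivial⟩

variable {w : PrimeSpectrum Ocyc → AddValuation Qcyc (WithTop ℚ)}

theorem exists_forall_scaleBot_thetaSingle_eq (hw : ∀ P, IsPointValuation P (w P))
    (P : PrimeSpectrum Ocyc) (f : Qcyc) :
    ∃ (g : Qcyc) (x : WithBot ℤ) (c : thetaStalk (specMap P)), w P g = w P f ∧
      ∀ Q, scaleBot (thetaSingle c (specMap Q)) x = negValue (w Q g) := by
  cases hf : w P f with
  | top => exact ⟨0, ⊥, thetaZero _, (w P).map_zero, fun Q => by rw [(w Q).map_zero]; rfl⟩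
  | coe r =>
    have hr := ((hw P).exists_map_eq_coe_iff r).mp ⟨f, hf⟩
    obtain ⟨g, hg⟩ := exists_forall_isPointValuation_map_eq hr
    obtain ⟨⟨x, c⟩, hxc⟩ := exists_stalkValue_eq_coe_iff.mpr (neg_mem hr)
    have hxc : scaleBot c x = (-r : ℚ) := hxc
    refine ⟨g, x, c, (hg P _ (hw P)).1 rfl, fun Q => ?_⟩
    by_cases hQ : specMap Q = specMap P
    · rw [(hg Q _ (hw Q)).1 hQ, hQ, thetaSingle_same]
      exact hxc
    · rw [(hg Q _ (hw Q)).2 hQ, thetaSingle_of_ne c hQ, negValue_zero]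
      cases x with
      | none => exact absurd hxc WithBot.bot_ne_coe
      | some m => exact congrArg WithBot.some (mul_zero (m : ℚ))

theorem exists_isHyperringIso_stalkValue_eq (hw : ∀ P, IsPointValuation P (w P)) :
    ∃ Φ : (cartierSheaf Ocyc Qcyc).toSheaf ≅ pullbackStructureSheaf.toSheaf,
      IsHyperringIso Φ ∧ ∀ {U} (s : (cartierSheaf Ocyc Qcyc).Sections U) (P : U),
        stalkValue (specMap P.1) (pullbackStructureSheaf.germ (mapSec Φ s) P) =
          (hw P.1).hasLocalRing.negValuation ((cartierSheaf Ocyc Qcyc).germ s P) := by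
  refine exists_isHyperringIso_of_isTropical isSheafOfHyperrings_cartierSheaf_cyc
    isSheafOfHyperrings_pullbackStructureSheaf (fun P => (hw P).isTropical_negValuation)
    (fun P => isTropical_stalkValue (specMap P)) fun P t => ?_
  obtain ⟨f, rfl⟩ := exists_germ_principalSec t
  obtain ⟨g, x, c, hg, hxc⟩ := exists_forall_scaleBot_thetaSingle_eq hw P f
  exact ⟨⊤, trivial, principalSec g, pullbackTmulSec x c,
    (hw P).hasLocalRing.mk_eq_mk_iff.mpr hg, fun Q => hxc Q.1⟩

theorem germ_mapSec_eq_germ_mapSec_of_asIdeal_eq_bot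
    {Φ Ψ : (cartierSheaf Ocyc Qcyc).toSheaf ≅ pullbackStructureSheaf.toSheaf}
    (hΦ : IsHyperringIso Φ) (hΨ : IsHyperringIso Ψ) {U : Opens (TopCat.of (PrimeSpectrum Ocyc))}
    (s : (cartierSheaf Ocyc Qcyc).Sections U) {P : U} (hP : P.1.asIdeal = ⊥) :
    pullbackStructureSheaf.germ (mapSec Φ s) P = pullbackStructureSheaf.germ (mapSec Ψ s) P := by
  have hC := isSheafOfHyperrings_cartierSheaf_cyc
  obtain ⟨f, hf⟩ := exists_germ_principalSec ((cartierSheaf Ocyc Qcyc).germ s P)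
  obtain ⟨w, hw⟩ := exists_isPointValuation P.1
  rcases eq_or_ne f 0 with rfl | hf0
  · exact (germ_mapSec_eq_zero hC hΦ hf.symm).trans (germ_mapSec_eq_zero hC hΨ hf.symm).symm
  · have hs : (cartierSheaf Ocyc Qcyc).germ s P = ((cartierSheaf Ocyc Qcyc).str P.1).one :=
      hf.symm.trans <| hw.hasLocalRing.mk_eq_mk_iff.mpr <|
        (hw.map_eq_zero_of_asIdeal_eq_bot hP hf0).trans w.map_one.symm
    exact (germ_mapSec_eq_one hC hΦ hs).trans (germ_mapSec_eq_one hC hΨ hs).symm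

theorem proposition4p7 :
    (∀ (p : ℕ) (P : PrimeSpectrum Ocyc), p.Prime → (p : Ocyc) ∈ P.asIdeal →
      ∃! v : AddValuation Qcyc (WithTop ℚ), IsNormalizedValuation p P v) ∧
    (∀ (p : ℕ) (P : PrimeSpectrum Ocyc) (v : AddValuation Qcyc (WithTop ℚ)),
      p.Prime → (p : Ocyc) ∈ P.asIdeal → IsNormalizedValuation p P v →
      {r : ℚ | ∃ f : Qcyc, v f = (r : WithTop ℚ)} = (fractionGroup p : Set ℚ)) ∧
    (cartierSheaf Ocyc Qcyc).IsSheafOfHyperrings ∧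
    pullbackStructureSheaf.IsSheafOfHyperrings ∧
    ∃! Φ : (cartierSheaf Ocyc Qcyc).toSheaf ≅ pullbackStructureSheaf.toSheaf,
      HyperSheaf.IsHyperringIso Φ ∧
      ∀ (U : Opens (TopCat.of (PrimeSpectrum Ocyc)))
        (s : (cartierSheaf Ocyc Qcyc).Sections U) (P : U) (f : Qcyc),
        (cartierSheaf Ocyc Qcyc).germ s P =
          UnitQuotient.mk (localUnits Ocyc Qcyc P.1) f →
        ∀ (p : ℕ) (v : AddValuation Qcyc (WithTop ℚ)), p.Prime → (p : Ocyc) ∈ P.1.asIdeal →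
          IsNormalizedValuation p P.1 v →
          stalkValue (specMap P.1)
            (pullbackStructureSheaf.germ (HyperSheaf.mapSec Φ s) P) = negValue (v f) := by
  choose w hw using exists_isPointValuation
  refine ⟨fun p P hp hP => existsUnique_isNormalizedValuation hp hP,
    fun p P v hp hP hv => hv.setOf_map_eq_coe hp hP, isSheafOfHyperrings_cartierSheaf_cyc,
    isSheafOfHyperrings_pullbackStructureSheaf, ?_⟩
  obtain ⟨Φ, hΦ, hval⟩ := exists_isHyperringIso_stalkValue_eq hw
  refine ⟨Φ, ⟨hΦ, fun U s P f hs p v hp hP hv => ?_⟩, ?_⟩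
  · rw [hval, hs, (existsUnique_isNormalizedValuation hp hP).unique hv
      ((hw P.1).isNormalized p hp hP)]
    rfl
  · rintro Ψ ⟨hΨ, hΨval⟩
    refine iso_ext fun U s P => ?_
    rcases asIdeal_eq_bot_or_exists_prime_mem P.1 with hP | ⟨p, hp, hP⟩
    · exact germ_mapSec_eq_germ_mapSec_of_asIdeal_eq_bot hΨ hΦ s hP
    · obtain ⟨f, hf⟩ := exists_germ_principalSec ((cartierSheaf Ocyc Qcyc).germ s P)
      refine stalkValue_injective _ ?_
      rw [hΨval U s P f hf.symm p (w P.1) hp hP ((hw P.1).isNormalized p hp hP), hval, ← hf]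
      rfl
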